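/- A $2$-$(v,5,\lambda)$ design is a pair $(X,\mathcal B)$, where $X$ is a set of $v$ points and $\mathcal B$ is a set of $5$-subsets of $X$ (blocks), $\emptyset\neq\mathcal B\neq\binom{X}{5}$, such that every $2$-subset of $X$ is contained in exactly $\lambda$ blocks. Let $\mathcal S_n^{[2]}$ be the permutation group induced by $\mathrm{Sym}(V)$, $|V|=n$, on the set $\binom{V}{2}$ of $2$-subsets of $V$. The design is graphical if $v=\binom n2$ for some $n$ and the design has a group $H$ of automorphisms that is permutation isomorphic to $\mathcal S_n^{[2]}$. Two graphical designs $(X,\mathcal A)$ and $(Y,\mathcal B)$ with individualized such groups $H$ and $K$ are equivalent if there is a bijection $\sigma:X\to Y$ with $\sigma(\mathcal A)=\mathcal B$ and $\sigma H\sigma^{-1}=K$. Let $\Psi(2,5)$ be the set of pairs $(v,\lambda)$ with $\lambda\le\frac12\binom{v-2}{3}$ for which a graphical $2$-$(v,5,\lambda)$ design exists. Theorem. The set $\Psi(2,5)$ has exactly $8619$ elements. Up to equivalence, there are exactly $271360$ graphical $2$-$(\binom n2,5,\lambda)$ designs with $\lambda\le\frac12\binom{\binom n2-2}{3}$ ($n$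 and $\lambda$ ranging over all values). For $n\ge 40$ there is no graphical $2$-$(\binom n2,5,\lambda)$ design, for any $\lambda$. -/

import Mathlib

namespace GraphicalDesigns

open Equiv

/-- The image `σ(B)` of a family `B` of finite subsets of `X` under a bijection `σ : X → Y`. -/
def mapBlocks {X Y : Type*} (σ : X ≃ Y) (B : Set (Finset X)) : Set (Finset Y) :=
  (fun b => b.map σ.toEmbedding) '' B

theorem mapBlocks_refl {X : Type*} (B : Set (Finset X)) : mapBlocks (Equiv.refl X) B = B := by
  ext b
  simp [mapBlocks]

theorem mapBlocks_trans {X Y Z : Type*} (σ : X ≃ Y) (τ : Y ≃ Z) (B : Set (Finset X)) :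
    mapBlocks (σ.trans τ) B = mapBlocks τ (mapBlocks σ B) := by
  simp only [mapBlocks, Set.image_image, Finset.map_map]
  rfl

theorem mapBlocks_symm {X Y : Type*} (σ : X ≃ Y) {A : Set (Finset X)} {B : Set (Finset Y)}
    (h : mapBlocks σ A = B) : mapBlocks σ.symm B = A := by
  rw [← h, ← mapBlocks_trans, Equiv.self_trans_symm, mapBlocks_refl]

/-- `(X, B)` is a (nontrivial) `t`-`(|X|, k, lam)` design: `2 ≤ t < k`, the blocks are `k`-subsets
of the point set `X`, every `t`-subset of `X` lies in exactly `lam` blocks, and `B` is neither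
empty nor the set of all `k`-subsets. -/
structure IsDesign (t k lam : ℕ) {X : Type*} (B : Set (Finset X)) : Prop where
  two_le : 2 ≤ t
  lt : t < k
  uniform : ∀ b ∈ B, b.card = k
  balanced : ∀ T : Finset X, T.card = t → {b ∈ B | T ⊆ b}.ncard = lam
  nonempty : B.Nonempty
  ne_all : B ≠ {b | b.card = k}

/-- The automorphism group of the set system `(X, B)`. -/
def autGroup {X : Type*} (B : Set (Finset X)) : Subgroup (Perm X) where
  carrier := {σ | mapBlocks σ B = B}
  one_mem' := mapBlocks_refl B
  mul_mem' := by
    intro σ τ hσ hτ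
    change mapBlocks (τ.trans σ) B = B
    rw [mapBlocks_trans, hτ, hσ]
  inv_mem' := by
    intro σ hσ
    exact mapBlocks_symm σ hσ

/-- The group `S_n^[2]`: the image of `Sym {0, …, n-1}` in the symmetric group on the
`2`-subsets of `{0, …, n-1}`, under the induced action. -/
def pairGroup (n : ℕ) : Subgroup (Perm (Set.powersetCard (Fin n) 2)) :=
  (MulAction.toPermHom (Perm (Fin n)) (Set.powersetCard (Fin n) 2)).range

/-- Permutation isomorphism of permutation groups `H` on `X` and `K` on `Y`. -/
def PermIsomorphic {X Y : Type*} (H : Subgroup (Perm X)) (K : Subgroup (Perm Y)) : Prop :=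
  ∃ (e : X ≃ Y) (φ : H ≃* K), ∀ (h : H) (x : X), e ((h : Perm X) x) = (φ h : Perm Y) (e x)

/-- A graphical `t`-`(v, k, lam)` design `(X, B)`, `v = C(n, 2)`, with an individualized group `H`
of automorphisms that is permutation isomorphic to `S_n^[2]`. -/
structure GraphicalDesign (t k : ℕ) where
  /-- the number of vertices of the underlying complete graph -/
  n : ℕ
  /-- the index of the design -/
  lam : ℕ
  /-- the point set -/
  X : Type
  finite : Finite X
  /-- the block set -/
  B : Set (Finset X)
  /-- the individualized group of automorphisms -/
  H : Subgroup (Perm X)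
  card_eq : Nat.card X = n.choose 2
  isDesign : IsDesign t k lam B
  le_aut : H ≤ autGroup B
  permIso : PermIsomorphic H (pairGroup n)

/-- The order (number of points) of a graphical design. -/
noncomputable def GraphicalDesign.order {t k : ℕ} (D : GraphicalDesign t k) : ℕ := Nat.card D.X

/-- Equivalence of graphical designs with individualized groups: an isomorphism `σ` of the designs
with `σ H σ⁻¹ = K`. (`σ.permCongrHom h` is `σ h σ⁻¹`.) -/
def GraphicalDesign.Equivalent {t k : ℕ} (D E : GraphicalDesign t k) : Prop :=
  ∃ σ : D.X ≃ E.X, mapBlocks σ D.B = E.B ∧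
    D.H.map (σ.permCongrHom : Perm D.X →* Perm E.X) = E.H

/-- Equivalence of graphical designs as a setoid. -/
def equivalenceSetoid (t k : ℕ) : Setoid (GraphicalDesign t k) where
  r := GraphicalDesign.Equivalent
  iseqv :=
    { refl := fun D => ⟨Equiv.refl _, mapBlocks_refl _, by
        convert Subgroup.map_id D.H
        ext g x
        simp⟩
      symm := by
        rintro D E ⟨σ, hB, hH⟩
        refine ⟨σ.symm, mapBlocks_symm σ hB, ?_⟩
        rw [← hH, Subgroup.map_map]
        convert Subgroup.map_id D.H
        ext g x
        simp
      trans := by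
        rintro D E F ⟨σ, hB, hH⟩ ⟨τ, hB', hH'⟩
        refine ⟨σ.trans τ, by rw [mapBlocks_trans, hB, hB'], ?_⟩
        rw [← hH', ← hH, Subgroup.map_map]
        congr 1 }

/-- A graphical `t`-`(v, k, lam)` design exists. -/
def ExistsGraphicalDesign (t v k lam : ℕ) : Prop :=
  ∃ D : GraphicalDesign t k, D.order = v ∧ D.lam = lam

/-- `Λ(t, k, v)`: the `lam ≤ C(v - t, k - t) / 2` for which a graphical `t`-`(v, k, lam)` design
exists. -/
def Lam (t k v : ℕ) : Set ℕ :=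
  {lam | (lam : ℚ) ≤ 1 / 2 * ((v - t).choose (k - t) : ℚ) ∧ ExistsGraphicalDesign t v k lam}

/-- `Ψ(t, k)`: the set of pairs `(v, lam)` with `lam ∈ Λ(t, k, v)`. -/
def Psi (t k : ℕ) : Set (ℕ × ℕ) := {p | p.2 ∈ Lam t k p.1}

/-- The set of equivalence classes of graphical `t`-`(v, k, lam)` designs (over all `v` and `lam`)
with `lam ≤ C(v - t, k - t) / 2`. -/
def classes (t k : ℕ) : Set (Quotient (equivalenceSetoid t k)) :=
  Quotient.mk (equivalenceSetoid t k) ''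
    {D | (D.lam : ℚ) ≤ 1 / 2 * ((D.order - t).choose (k - t) : ℚ)}

end GraphicalDesigns

/-! A group permutation isomorphic to `pairGroup n` turns the points into the edges of K_n, and an
invariant block set is then a union of isomorphism classes of graphs with five edges and no isolated
vertices. There are 26 such graphs, and those with at most n vertices occur. So a design is a set S
of graph types (`family_graphsOf`, `graphsOf_family`).

Sym(n) has two orbits on pairs of edges, adjacent and disjoint, hence balance is two linear
conditions on S. A fraction 4/(n+1) of all pairs of edges is adjacent and a block has ten pairs, so
the blocks must contain 40/(n+1) adjacent pairs on average; the index is then read off from the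
number of blocks (`balanced_iff`).

If n ≥ 40, every graph except the perfect matching on ten vertices exceeds this average. A balanced
S without the matching is therefore empty; if S contains it, the same applies to the complement of
S, so only trivial families remain (`eq_empty_of_balance`, `lt_forty`). If n ≤ 4, at most one graph
fits. For 5 ≤ n ≤ 39 the sets S are counted as solutions of a subset-sum problem, by merging sorted
lists of partial sums with pruning (`countCheck_spec`).

Distinct S give inequivalent designs: for n ≥ 5 the group `pairGroup n` is its own normalizer
(`mem_pairGroup_of_normalizes`), so an equivalence is induced by a vertex permutation and preserves
every isomorphism class. Thus classes correspond to pairs (n, S), and Ψ to pairs of n and the number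
of blocks.

The list of 26 graphs and their numbers of copies are derived by adding edges one at a time
(`sum_map_extensions`, `Pattern.Represents.next`). Completeness of the list follows from the
resulting summation identity, applied to the indicator of an orbit (`exists_copy`). -/

namespace GraphicalDesigns

open Equiv Finset

/-! ### Patterns and the addition of one edge -/

/-- The image of a set of edges under a permutation of the vertices. -/
def relabel (σ : Perm ℕ) (b : Finset (Finset ℕ)) : Finset (Finset ℕ) :=
  b.map (Finset.mapEmbedding σ.toEmbedding).toEmbedding

/-- The edges of the complete graph on `{0, …, n-1}`. -/
def completeEdges (n : ℕ) : Finset (Finset ℕ) := powersetCard 2 (range n)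

/-- Invariance under all transpositions of vertices below `n`. -/
def SwapInvariant (n : ℕ) (F : Finset (Finset ℕ) → ℕ) : Prop :=
  ∀ i < n, ∀ j < n, ∀ b, F (relabel (swap i j) b) = F b

theorem relabel_insert (σ : Perm ℕ) (e : Finset ℕ) (b : Finset (Finset ℕ)) :
    relabel σ (insert e b) = insert (e.map σ.toEmbedding) (relabel σ b) := by
  simp [relabel, Finset.map_insert]

theorem map_mem_relabel {σ : Perm ℕ} {e : Finset ℕ} {b : Finset (Finset ℕ)} :
    e.map σ.toEmbedding ∈ relabel σ b ↔ e ∈ b := by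
  simp [relabel]

theorem map_pair (σ : Perm ℕ) (i j : ℕ) :
    ({i, j} : Finset ℕ).map σ.toEmbedding = {σ i, σ j} := by
  simp [Finset.map_insert]

theorem swap_lt {n i j v : ℕ} (hi : i < n) (hj : j < n) (hv : v < n) : swap i j v < n := by
  rw [swap_apply_def]
  split_ifs <;> assumption

/-- The set of edges given by a list of pairs of vertices. -/
def edgeSet (L : List (ℕ × ℕ)) : Finset (Finset ℕ) :=
  (L.map fun p => ({p.1, p.2} : Finset ℕ)).toFinset

@[simp] theorem edgeSet_nil : edgeSet [] = ∅ := rfl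

theorem edgeSet_cons (p : ℕ × ℕ) (L : List (ℕ × ℕ)) :
    edgeSet (p :: L) = insert {p.1, p.2} (edgeSet L) := by
  simp [edgeSet]

theorem mem_edgeSet {L : List (ℕ × ℕ)} {e : Finset ℕ} :
    e ∈ edgeSet L ↔ ∃ p ∈ L, ({p.1, p.2} : Finset ℕ) = e := by
  simp [edgeSet]

/-- A graph on vertices `0, …, order - 1` with a multiplicity. -/
structure Pattern where
  /-- the multiplicity -/
  coeff : ℕ
  /-- the number of vertices -/
  order : ℕ
  /-- the list of edges -/
  edges : List (ℕ × ℕ)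
deriving DecidableEq

namespace Pattern

/-- The edges `{i, j}` are written `(i, j)` with `i < j`, and use only vertices below `order`. -/
def Valid (p : Pattern) : Prop := ∀ e ∈ p.edges, e.1 < e.2 ∧ e.2 < p.order

/-- The number of labelled copies of the pattern in the complete graph on `n` vertices, times the
multiplicity, times the value of `F`. -/
def value (n : ℕ) (F : Finset (Finset ℕ) → ℕ) (p : Pattern) : ℕ :=
  p.coeff * n.descFactorial p.order * F (edgeSet p.edges)

/-- All ways to add an edge to a pattern, up to permutations of the unused vertices. -/
def extensions (p : Pattern) : List Pattern :=
  ((List.range p.order).flatMap fun v => ((List.range v).filter fun u => (u, v) ∉ p.edges).map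
    fun u => ⟨2 * p.coeff, p.order, (u, v) :: p.edges⟩) ++
  ((List.range p.order).map fun u => ⟨2 * p.coeff, p.order + 1, (u, p.order) :: p.edges⟩) ++
  [⟨p.coeff, p.order + 2, (p.order, p.order + 1) :: p.edges⟩]

/-- The sum over the ordered pairs of vertices that are joined by an edge outside `b` of the value
of `F` at `b` with that edge added. -/
def gain (F : Finset (Finset ℕ) → ℕ) (b : Finset (Finset ℕ)) (u v : ℕ) : ℕ :=
  if u = v ∨ {u, v} ∈ b then 0 else F (insert {u, v} b)

theorem gain_comm (F : Finset (Finset ℕ) → ℕ) (b : Finset (Finset ℕ)) (u v : ℕ) :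
    gain F b u v = gain F b v u := by
  simp only [gain, Finset.pair_comm u v, eq_comm (a := u)]

theorem gain_relabel {n : ℕ} {F : Finset (Finset ℕ) → ℕ} (hF : SwapInvariant n F) {i j : ℕ}
    (hi : i < n) (hj : j < n) (b : Finset (Finset ℕ)) (u v : ℕ) :
    gain F (relabel (swap i j) b) (swap i j u) (swap i j v) = gain F b u v := by
  simp only [gain, ← map_pair, map_mem_relabel, ← relabel_insert, hF i hi j hj,
    EmbeddingLike.apply_eq_iff_eq]

theorem relabel_swap_edgeSet {p : Pattern} (hp : p.Valid) {i j : ℕ} (hi : p.order ≤ i)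
    (hj : p.order ≤ j) : relabel (swap i j) (edgeSet p.edges) = edgeSet p.edges := by
  have key : ∀ L : List (ℕ × ℕ), (∀ e ∈ L, e.1 < e.2 ∧ e.2 < p.order) →
      relabel (swap i j) (edgeSet L) = edgeSet L := by
    intro L
    induction L with
    | nil => intro _; rfl
    | cons e L ih =>
      intro h
      have he := h e (by simp)
      rw [edgeSet_cons, relabel_insert, ih fun e he => h e (by simp [he]), map_pair,
        swap_apply_of_ne_of_ne (by omega) (by omega), swap_apply_of_ne_of_ne (by omega) (by omega)]
  exact key _ hp

theorem gain_swap {n : ℕ} {F : Finset (Finset ℕ) → ℕ} (hF : SwapInvariant n F) {p : Pattern}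
    (hp : p.Valid) {i j : ℕ} (hi : i < n) (hj : j < n) (hi' : p.order ≤ i) (hj' : p.order ≤ j)
    (u v : ℕ) : gain F (edgeSet p.edges) (swap i j u) (swap i j v) =
      gain F (edgeSet p.edges) u v := by
  conv_rhs => rw [← gain_relabel hF hi hj, relabel_swap_edgeSet hp hi' hj']

theorem sum_range_swap {n i j : ℕ} (hi : i < n) (hj : j < n) (h : ℕ → ℕ) :
    ∑ v ∈ range n, h (swap i j v) = ∑ v ∈ range n, h v :=
  Finset.sum_equiv (swap i j) (fun v => by
    simp only [mem_range]
    exact ⟨fun hv => swap_lt hi hj hv, fun hv => by simpa using swap_lt hi hj hv⟩) (by simp)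

/-- All vertices not yet used by a pattern of order `k` contribute alike, so `k` can stand for each
of them; their number n − k turns one falling factorial into the next. For n < k both sides vanish.
-/
theorem descFactorial_mul_sum (n k : ℕ) (h : ℕ → ℕ) (hh : ∀ v, k ≤ v → v < n → h v = h k) :
    n.descFactorial k * ∑ v ∈ range n, h v =
      n.descFactorial k * ∑ v ∈ range k, h v + n.descFactorial (k + 1) * h k := by
  rcases lt_or_ge n k with hn | hn
  · simp [Nat.descFactorial_eq_zero_iff_lt.2 hn, Nat.descFactorial_succ]
  · rw [← Finset.sum_range_add_sum_Ico _ hn, Finset.sum_congr rfl (fun v hv =>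
      hh v (mem_Ico.1 hv).1 (mem_Ico.1 hv).2 : ∀ v ∈ Ico k n, h v = h k)]
    simp [Nat.descFactorial_succ]
    ring

theorem sum_sum_range_comm (k : ℕ) (g : ℕ → ℕ → ℕ) (hs : ∀ u v, g u v = g v u)
    (h0 : ∀ u, g u u = 0) : ∑ u ∈ range k, ∑ v ∈ range k, g u v =
      2 * ∑ v ∈ range k, ∑ u ∈ range v, g u v := by
  induction k with
  | zero => simp
  | succ k ih =>
    simp only [Finset.sum_range_succ, Finset.sum_add_distrib, ih, h0]
    rw [Finset.sum_congr rfl fun v _ => hs k v]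
    ring

theorem mem_edgeSet_pair {L : List (ℕ × ℕ)} (hL : ∀ e ∈ L, e.1 < e.2) {u v : ℕ} (h : u < v) :
    {u, v} ∈ edgeSet L ↔ (u, v) ∈ L := by
  rw [mem_edgeSet]
  constructor
  · rintro ⟨⟨a, b⟩, hab, h'⟩
    have := hL _ hab
    have h1 : a ∈ ({u, v} : Finset ℕ) := h' ▸ by simp
    have h2 : b ∈ ({u, v} : Finset ℕ) := h' ▸ by simp
    simp only [Finset.mem_insert, Finset.mem_singleton] at h1 h2 this
    obtain rfl : a = u := by omega
    obtain rfl : b = v := by omega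
    exact hab
  · exact fun h => ⟨_, h, rfl⟩

theorem sum_map_filter_range (k : ℕ) (P : ℕ → Prop) [DecidablePred P] (h : ℕ → ℕ) :
    (((List.range k).filter P).map h).sum = ∑ u ∈ range k, if P u then h u else 0 := by
  rw [← Finset.sum_filter]
  rfl

theorem sum_map_range (k : ℕ) (h : ℕ → ℕ) : ((List.range k).map h).sum = ∑ u ∈ range k, h u :=
  rfl

/-- The recursion step of the enumeration. An ordered pair of new ends has both ends old, exactly
one old, or both new. The first two kinds arise in two orientations, whence the doubled
coefficients; in the third the orientations are already counted by the falling factorial. -/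
theorem sum_map_extensions {n : ℕ} {F : Finset (Finset ℕ) → ℕ} (hF : SwapInvariant n F)
    {p : Pattern} (hp : p.Valid) :
    p.value n (fun b => ∑ u ∈ range n, ∑ v ∈ range n, gain F b u v) =
      (p.extensions.map (value n F)).sum := by
  obtain ⟨C, k, L⟩ := p
  set b := edgeSet L with hb
  set g := gain F b with hg
  have hsw : ∀ i j, i < n → j < n → k ≤ i → k ≤ j → ∀ u v, g (swap i j u) (swap i j v) = g u v :=
    fun i j hi hj hi' hj' u v => gain_swap hF hp hi hj hi' hj' u v
  have hfix : ∀ u v w, k ≤ v → v < n → k ≤ w → w < n → u ≠ v → u ≠ w → g u v = g u w := by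
    intro u v w h1 h2 h3 h4 h5 h6
    rw [← hsw w v h4 h2 h3 h1 u v, swap_apply_right, swap_apply_of_ne_of_ne h6 h5]
  have h0 : ∀ u, g u u = 0 := fun u => by simp [hg, gain]
  have hs : ∀ u v, g u v = g v u := gain_comm F b
  have hnew : ∀ u v, u < v → k ≤ v → g u v = F (edgeSet ((u, v) :: L)) := by
    intro u v huv hv
    have : ({u, v} : Finset ℕ) ∉ edgeSet L := by
      rw [mem_edgeSet_pair (fun e he => (hp e he).1) huv]
      intro h
      exact absurd (hp _ h).2 (by simpa using hv)
    rw [hg, gain, if_neg (by simp [huv.ne, hb, this]), hb, edgeSet_cons]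
  -- Split the first end `u`, then the second end `v`, into used vertices and a representative
  -- unused one. Once `u = k` is used, the next representative is `k + 1`.
  have houter := descFactorial_mul_sum n k (fun u => ∑ v ∈ range n, g u v) (by
    intro u hu hun
    rw [← sum_range_swap hun (by omega : k < n) (fun v => g u v)]
    refine Finset.sum_congr rfl fun v _ => ?_
    rw [← hsw u k hun (by omega) hu le_rfl k v, swap_apply_right])
  have hinner : ∀ u ∈ range k, n.descFactorial k * ∑ v ∈ range n, g u v =
      n.descFactorial k * ∑ v ∈ range k, g u v + n.descFactorial (k + 1) * g u k := by
    intro u hu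
    rw [mem_range] at hu
    exact descFactorial_mul_sum n k _ fun v hv hvn =>
      hfix u v k hv hvn le_rfl (by omega) (by omega) (by omega)
  have hlast := descFactorial_mul_sum n (k + 1) (fun v => g k v) fun v hv hvn =>
    hfix k v (k + 1) (by omega) hvn (by omega) (by omega) (by omega) (by omega)
  rw [Finset.mul_sum (range k), Finset.sum_congr rfl hinner, Finset.sum_add_distrib,
    ← Finset.mul_sum, ← Finset.mul_sum, hlast, sum_sum_range_comm k g hs h0, Finset.sum_range_succ, h0,
    Finset.sum_congr rfl fun v _ => hs k v, hnew k (k + 1) (by omega) (by omega)] at houter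
  have e1 : ((((List.range k).flatMap fun v => ((List.range v).filter fun u => (u, v) ∉ L).map
      fun u => (⟨2 * C, k, (u, v) :: L⟩ : Pattern))).map (value n F)).sum =
      2 * C * n.descFactorial k * ∑ v ∈ range k, ∑ u ∈ range v, g u v := by
    rw [List.map_flatMap, List.flatMap_def, List.sum_flatten, List.map_map, sum_map_range,
      Finset.mul_sum]
    refine Finset.sum_congr rfl fun v _ => ?_
    rw [Function.comp_apply, List.map_map, sum_map_filter_range, Finset.mul_sum]
    refine Finset.sum_congr rfl fun u hu => ?_
    rw [mem_range] at hu
    simp only [hg, gain, hu.ne, false_or, hb, mem_edgeSet_pair (fun e he => (hp e he).1) hu]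
    by_cases h : (u, v) ∈ L <;> simp [h, value, edgeSet_cons]
  have e2 : (((List.range k).map fun u => (⟨2 * C, k + 1, (u, k) :: L⟩ : Pattern)).map
      (value n F)).sum = 2 * C * n.descFactorial (k + 1) * ∑ u ∈ range k, g u k := by
    rw [List.map_map, sum_map_range, Finset.mul_sum]
    refine Finset.sum_congr rfl fun u hu => ?_
    rw [mem_range] at hu
    rw [hnew u k hu le_rfl]
    rfl
  simp only [extensions, List.map_append, List.sum_append, e1, e2]
  simp only [value, List.map_cons, List.map_nil, List.sum_cons, List.sum_nil]
  rw [mul_assoc, houter]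
  ring

end Pattern
-- Summation over sets of edges
theorem sum_completeEdges (n : ℕ) (h : Finset ℕ → ℕ) :
    ∑ e ∈ completeEdges n, h e = ∑ v ∈ range n, ∑ u ∈ range v, h {u, v} := by
  induction n with
  | zero => rfl
  | succ n ih =>
    have hdisj : Disjoint (powersetCard 2 (range n)) ((powersetCard 1 (range n)).image (insert n)) := by
      rw [Finset.disjoint_right]
      intro e he h
      obtain ⟨a, -, rfl⟩ := Finset.mem_image.1 he
      have := (mem_powersetCard.1 h).1 (mem_insert_self n a)
      simp at this
    rw [Finset.sum_range_succ, ← ih, completeEdges, Finset.range_add_one,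
      Finset.powersetCard_succ_insert (by simp), Finset.sum_union hdisj]
    congr 1
    rw [Finset.sum_image, Finset.powersetCard_one, Finset.sum_map]
    · exact Finset.sum_congr rfl fun u _ => by simp [Finset.pair_comm]
    · intro a ha b hb hab
      have hn : ∀ c ∈ (powersetCard 1 (range n) : Finset (Finset ℕ)), n ∉ c := fun c hc h => by
        simpa using (mem_powersetCard.1 hc).1 h
      rw [← Finset.erase_insert (hn a ha), ← Finset.erase_insert (hn b hb)]
      exact congrArg (fun s => Finset.erase s n) hab

/-- Double counting: a set of size m with a further element is the same as a set of size m + 1 with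
a marked element. -/
theorem sum_insert_powersetCard {α : Type*} [DecidableEq α] (E : Finset α) (m : ℕ)
    (F : Finset α → ℕ) :
    ∑ b ∈ powersetCard m E, ∑ e ∈ E, (if e ∈ b then 0 else F (insert e b)) =
      (m + 1) * ∑ b ∈ powersetCard (m + 1) E, F b := by
  have h1 : (m + 1) * ∑ b ∈ powersetCard (m + 1) E, F b =
      ∑ b ∈ powersetCard (m + 1) E, ∑ _e ∈ b, F b := by
    rw [Finset.mul_sum]
    refine Finset.sum_congr rfl fun b hb => ?_
    rw [Finset.sum_const, (mem_powersetCard.1 hb).2, smul_eq_mul]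
  have h2 : ∀ b ∈ powersetCard m E, ∑ e ∈ E, (if e ∈ b then 0 else F (insert e b)) =
      ∑ e ∈ E \ b, F (insert e b) := by
    intro b _
    rw [← Finset.filter_notMem_eq_sdiff, Finset.sum_filter]
    exact Finset.sum_congr rfl fun e _ => by by_cases h : e ∈ b <;> simp [h]
  rw [h1, Finset.sum_congr rfl h2, Finset.sum_sigma', Finset.sum_sigma']
  refine Finset.sum_bij' (fun x _ => ⟨insert x.2 x.1, x.2⟩) (fun x _ => ⟨x.1.erase x.2, x.2⟩)
    ?_ ?_ ?_ ?_ ?_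
  · rintro ⟨b, e⟩ h
    simp only [mem_sigma, mem_powersetCard, mem_sdiff] at h ⊢
    exact ⟨⟨insert_subset h.2.1 h.1.1, by rw [card_insert_of_notMem h.2.2, h.1.2]⟩, by simp⟩
  · rintro ⟨b, e⟩ h
    simp only [mem_sigma, mem_powersetCard, mem_sdiff] at h ⊢
    refine ⟨⟨(erase_subset _ _).trans h.1.1, by rw [card_erase_of_mem h.2, h.1.2]; rfl⟩,
      h.1.1 h.2, by simp⟩
  · rintro ⟨b, e⟩ h
    simp only [mem_sigma, mem_sdiff] at h
    simp [h.2.2]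
  · rintro ⟨b, e⟩ h
    simp only [mem_sigma] at h
    simp [h.2]
  · rintro ⟨b, e⟩ _
    rfl

namespace Pattern

theorem sum_gain (n m : ℕ) (F : Finset (Finset ℕ) → ℕ) :
    ∑ b ∈ powersetCard m (completeEdges n), ∑ u ∈ range n, ∑ v ∈ range n, gain F b u v =
      2 * (m + 1) * ∑ b ∈ powersetCard (m + 1) (completeEdges n), F b := by
  rw [mul_assoc, ← sum_insert_powersetCard, Finset.mul_sum]
  refine Finset.sum_congr rfl fun b _ => ?_
  rw [sum_sum_range_comm n (gain F b) (gain_comm F b) fun u => by simp [gain], sum_completeEdges]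
  congr 1
  refine Finset.sum_congr rfl fun v _ => Finset.sum_congr rfl fun u hu => ?_
  simp [gain, (mem_range.1 hu).ne]

theorem gain_sum_swapInvariant {n : ℕ} {F : Finset (Finset ℕ) → ℕ} (hF : SwapInvariant n F) :
    SwapInvariant n fun b => ∑ u ∈ range n, ∑ v ∈ range n, gain F b u v := by
  intro i hi j hj b
  dsimp only
  rw [← sum_range_swap hi hj]
  refine Finset.sum_congr rfl fun u _ => ?_
  rw [← sum_range_swap hi hj]
  exact Finset.sum_congr rfl fun v _ => gain_relabel hF hi hj b u v

/-! ### Enumeration of graphs by the number of edges -/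

/-- A list of patterns represents the sets of `m` edges if it computes the sum of every invariant
function over them. -/
def Represents (m : ℕ) (t : List Pattern) : Prop :=
  ∀ n F, SwapInvariant n F →
    2 ^ m * m.factorial * ∑ b ∈ powersetCard m (completeEdges n), F b = (t.map (value n F)).sum

theorem represents_zero : Represents 0 [⟨1, 0, []⟩] := by
  intro n F _
  simp [value]

theorem Represents.extend {m : ℕ} {t : List Pattern} (h : Represents m t)
    (ht : ∀ p ∈ t, p.Valid) : Represents (m + 1) (t.flatMap extensions) := by
  intro n F hF
  have := h n _ (gain_sum_swapInvariant hF)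
  rw [sum_gain] at this
  rw [List.map_flatMap, List.flatMap_def, List.sum_flatten, List.map_map, pow_succ,
    Nat.factorial_succ]
  calc _ = 2 ^ m * m.factorial *
        (2 * (m + 1) * ∑ b ∈ powersetCard (m + 1) (completeEdges n), F b) := by ring
    _ = _ := by
      rw [this]
      exact congrArg List.sum (List.map_congr_left fun p hp => sum_map_extensions hF (ht p hp))

/-- Successively exchange the vertices `i, i + 1, …` with the vertices in the given list. -/
def shuffle (k : ℕ) : ℕ → List ℕ → List (ℕ × ℕ) → List (ℕ × ℕ)
  | _, [], L => L
  | i, s :: w, L => shuffle k (i + 1) w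
      (if i < k ∧ s < k then L.map fun e => (swap i s e.1, swap i s e.2) else L)

/-- Write every edge with the smaller vertex first, and sort the edges. -/
def normalize (L : List (ℕ × ℕ)) : List (ℕ × ℕ) :=
  (L.map fun e => (min e.1 e.2, max e.1 e.2)).insertionSort
    fun e f => e.1 < f.1 ∨ e.1 = f.1 ∧ e.2 ≤ f.2

/-- Add a pattern to a list of patterns, merging it with an equal one. -/
def absorb : List Pattern → Pattern → List Pattern
  | [], p => [p]
  | q :: l, p => if q.order = p.order ∧ q.edges = p.edges then
      ⟨q.coeff + p.coeff, q.order, q.edges⟩ :: l else q :: absorb l p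

/-- Relabel the patterns in a list as prescribed. -/
def relabelAll : List Pattern → List (List ℕ) → List Pattern
  | [], _ => []
  | p :: l, w => ⟨p.coeff, p.order, normalize (shuffle p.order 0 (w.headD []) p.edges)⟩ ::
      relabelAll l w.tail

theorem edgeSet_map_swap (i j : ℕ) (L : List (ℕ × ℕ)) :
    edgeSet (L.map fun e => (swap i j e.1, swap i j e.2)) = relabel (swap i j) (edgeSet L) := by
  induction L with
  | nil => rfl
  | cons e L ih => rw [List.map_cons, edgeSet_cons, ih, edgeSet_cons, relabel_insert, map_pair]

/-- Only vertices below `k ≤ n` are exchanged, so invariance applies whatever the list `w` is.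
Relabelling hints therefore need no correctness condition. -/
theorem edgeSet_shuffle {n : ℕ} {F : Finset (Finset ℕ) → ℕ} (hF : SwapInvariant n F) {k : ℕ}
    (hk : k ≤ n) (w : List ℕ) : ∀ i L, F (edgeSet (shuffle k i w L)) = F (edgeSet L) := by
  induction w with
  | nil => intro i L; rfl
  | cons s w ih =>
    intro i L
    rw [shuffle, ih]
    split_ifs with h
    · rw [edgeSet_map_swap, hF i (by omega) s (by omega)]
    · rfl

theorem edgeSet_normalize (L : List (ℕ × ℕ)) : edgeSet (normalize L) = edgeSet L := by
  ext e
  simp only [mem_edgeSet, normalize, (List.perm_insertionSort _ _).mem_iff, List.mem_map]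
  constructor
  · rintro ⟨_, ⟨a, ha, rfl⟩, rfl⟩
    refine ⟨a, ha, ?_⟩
    rcases le_total a.1 a.2 with h | h <;> simp [h, Finset.pair_comm]
  · rintro ⟨a, ha, rfl⟩
    refine ⟨_, ⟨a, ha, rfl⟩, ?_⟩
    rcases le_total a.1 a.2 with h | h <;> simp [h, Finset.pair_comm]

theorem sum_value_relabelAll {n : ℕ} {F : Finset (Finset ℕ) → ℕ} (hF : SwapInvariant n F)
    (l : List Pattern) : ∀ w, ((relabelAll l w).map (value n F)).sum = (l.map (value n F)).sum := by
  induction l with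
  | nil => intro w; rfl
  | cons p l ih =>
    intro w
    rw [relabelAll, List.map_cons, List.sum_cons, ih, List.map_cons, List.sum_cons]
    congr 1
    -- A pattern too large for K_n may be relabelled outside the range of invariance, but its
    -- falling factorial is zero.
    rcases lt_or_ge n p.order with h | h
    · simp [value, Nat.descFactorial_eq_zero_iff_lt.2 h]
    · simp only [value, edgeSet_normalize, edgeSet_shuffle hF h]

theorem sum_value_absorb (n : ℕ) (F : Finset (Finset ℕ) → ℕ) (l : List Pattern) (p : Pattern) :
    ((absorb l p).map (value n F)).sum = (l.map (value n F)).sum + p.value n F := by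
  induction l with
  | nil => simp [absorb]
  | cons q l ih =>
    rw [absorb]
    split_ifs with h
    · simp only [List.map_cons, List.sum_cons, value, h.1, h.2]
      ring
    · simp only [List.map_cons, List.sum_cons, ih, add_assoc]

theorem sum_value_foldl_absorb (n : ℕ) (F : Finset (Finset ℕ) → ℕ) (l : List Pattern) :
    ∀ t : List Pattern, ((l.foldl absorb t).map (value n F)).sum =
      (t.map (value n F)).sum + (l.map (value n F)).sum := by
  induction l with
  | nil => simp
  | cons p l ih =>
    intro t
    rw [List.foldl_cons, ih, sum_value_absorb, List.map_cons, List.sum_cons, add_assoc]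

/-- Extend, relabel according to hints, and merge equal patterns. Each operation preserves the sum
of values, so a table only has to be compared with the computed list. -/
theorem Represents.next {m : ℕ} {t : List Pattern} (h : Represents m t) (ht : ∀ p ∈ t, p.Valid)
    {t' : List Pattern} (w : List (List ℕ))
    (e : (relabelAll (t.flatMap extensions) w).foldl absorb [] = t') :
    Represents (m + 1) t' := by
  intro n F hF
  rw [← e, h.extend ht n F hF, sum_value_foldl_absorb, sum_value_relabelAll hF]
  simp

instance (p : Pattern) : Decidable p.Valid :=
  inferInstanceAs (Decidable (∀ e ∈ p.edges, e.1 < e.2 ∧ e.2 < p.order))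

/-! ### Tables of graphs with at most five edges -/

/-- The graphs with one edge and no isolated vertices. -/
def oneEdgePatterns : List Pattern :=
  [⟨1, 2, [(0,1)]⟩]

/-- The graphs with two edges and no isolated vertices. -/
def twoEdgePatterns : List Pattern :=
  [⟨4, 3, [(0,1), (0,2)]⟩,
    ⟨1, 4, [(0,1), (2,3)]⟩]

/-- The graphs with three edges and no isolated vertices. -/
def threeEdgePatterns : List Pattern :=
  [⟨8, 3, [(0,1), (0,2), (1,2)]⟩,
    ⟨8, 4, [(0,1), (0,2), (0,3)]⟩,
    ⟨24, 4, [(0,1), (0,2), (1,3)]⟩,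
    ⟨12, 5, [(0,3), (0,4), (1,2)]⟩,
    ⟨1, 6, [(0,1), (2,3), (4,5)]⟩]

/-- The graphs with four edges and no isolated vertices. -/
def fourEdgePatterns : List Pattern :=
  [⟨192, 4, [(0,1), (0,2), (0,3), (1,2)]⟩,
    ⟨32, 5, [(0,1), (0,2), (1,2), (3,4)]⟩,
    ⟨16, 5, [(0,1), (0,2), (0,3), (0,4)]⟩,
    ⟨192, 5, [(0,1), (0,3), (0,4), (1,2)]⟩,
    ⟨32, 6, [(0,3), (0,4), (0,5), (1,2)]⟩,
    ⟨48, 4, [(0,1), (0,2), (1,3), (2,3)]⟩,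
    ⟨192, 5, [(0,2), (0,3), (1,2), (1,4)]⟩,
    ⟨96, 6, [(0,1), (0,4), (1,5), (2,3)]⟩,
    ⟨48, 6, [(0,2), (0,3), (1,4), (1,5)]⟩,
    ⟨24, 7, [(0,5), (0,6), (1,2), (3,4)]⟩,
    ⟨1, 8, [(0,1), (2,3), (4,5), (6,7)]⟩]

/-- The graphs with five edges and no isolated vertices. -/
def fiveEdgePatterns : List Pattern :=
  [⟨960, 4, [(0,1), (0,2), (0,3), (1,2), (1,3)]⟩,
    ⟨960, 5, [(0,1), (0,2), (0,3), (0,4), (1,2)]⟩,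
    ⟨1920, 5, [(0,1), (0,2), (0,3), (1,2), (1,4)]⟩,
    ⟨1920, 5, [(0,1), (0,2), (0,3), (1,4), (2,3)]⟩,
    ⟨960, 6, [(0,1), (0,2), (0,5), (1,2), (3,4)]⟩,
    ⟨320, 6, [(0,4), (0,5), (1,2), (1,3), (2,3)]⟩,
    ⟨80, 7, [(0,1), (0,2), (1,2), (3,4), (5,6)]⟩,
    ⟨32, 6, [(0,1), (0,2), (0,3), (0,4), (0,5)]⟩,
    ⟨640, 6, [(0,1), (0,3), (0,4), (0,5), (1,2)]⟩,
    ⟨80, 7, [(0,3), (0,4), (0,5), (0,6), (1,2)]⟩,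
    ⟨1920, 5, [(0,2), (0,3), (0,4), (1,2), (1,3)]⟩,
    ⟨480, 6, [(0,1), (0,2), (0,3), (1,4), (1,5)]⟩,
    ⟨1920, 6, [(0,2), (0,4), (0,5), (1,2), (1,3)]⟩,
    ⟨1920, 6, [(0,1), (0,2), (0,5), (1,3), (2,4)]⟩,
    ⟨960, 7, [(0,1), (0,5), (0,6), (1,4), (2,3)]⟩,
    ⟨320, 7, [(0,4), (0,5), (0,6), (1,2), (1,3)]⟩,
    ⟨80, 8, [(0,5), (0,6), (0,7), (1,2), (3,4)]⟩,
    ⟨240, 6, [(0,1), (0,2), (1,3), (2,3), (4,5)]⟩,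
    ⟨384, 5, [(0,1), (0,2), (1,3), (2,4), (3,4)]⟩,
    ⟨1920, 6, [(0,2), (0,4), (1,3), (1,5), (2,3)]⟩,
    ⟨960, 7, [(0,2), (0,5), (1,2), (1,6), (3,4)]⟩,
    ⟨960, 7, [(0,3), (0,4), (1,2), (1,5), (2,6)]⟩,
    ⟨240, 8, [(0,1), (0,6), (1,7), (2,3), (4,5)]⟩,
    ⟨240, 8, [(0,4), (0,5), (1,6), (1,7), (2,3)]⟩,
    ⟨40, 9, [(0,7), (0,8), (1,2), (3,4), (5,6)]⟩,
    ⟨1, 10, [(0,1), (2,3), (4,5), (6,7), (8,9)]⟩]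

theorem represents_oneEdgePatterns : Represents 1 oneEdgePatterns := 
  represents_zero.next (by decide) (
    [[]]) (by decide +kernel)

theorem represents_twoEdgePatterns : Represents 2 twoEdgePatterns := 
  represents_oneEdgePatterns.next (by decide) (
    [[], [1], []]) (by decide +kernel)

theorem represents_threeEdgePatterns : Represents 3 threeEdgePatterns := 
  represents_twoEdgePatterns.next (by decide) (
    [[], [], [], [0,2], [0,3,4], [0,2], [1,2], [0,3,3], [1,3,3], [0,2,3], [1,2,3], [2,2],
    [3,3,3], []]) (by decide +kernel)

theorem represents_fourEdgePatterns : Represents 4 fourEdgePatterns := 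
  represents_threeEdgePatterns.next (by decide) (
    [[], [1], [2,2], [], [], [0,1,3], [0,2,3], [], [0,1,4,4], [0,2,4,4], [0,3,4], [0,4,5,4,5],
    [1], [0,1,3], [], [0,1,3], [1], [1,2], [0,3,3], [0,1,4,5], [], [0,2], [0,1,3,4], [0,2,3,4],
    [0,1,4], [0,2,4], [0,3,4], [], [0,1,3,4], [0,2,3,4], [0,3,3], [0,4,4,4], [0,1,2,5,6],
    [0,2,4,5], [1,2,4,5], [0,3,4,5,5], [1,3,4,5,5], [0,4], [1,4], [2,4,2,4], [3,4,3,4],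
    [0,5,2,3,5], [1,5,2,3,5], [2,5,2,5,5], [3,5,3,5,5], [0,2,3,4,5], [1,2,3,4,5], [2,2,2,4,5],
    [3,3,3,4,5], [4,4,4,4], [5,5,5,5,5], []]) (by decide +kernel)

/-- The hints, one list per extension, bring isomorphic extensions to a common labelling so that
they merge into 26 patterns. -/
theorem represents_fiveEdgePatterns : Represents 5 fiveEdgePatterns := 
  represents_fourEdgePatterns.next (by decide) (
    [[], [0,2], [], [], [0,2], [0,3,3], [0,1,2,4,5], [0,3,3], [1,3,3], [2,3], [0,4,4,4],
    [1,4,4,4], [2,4,2,4], [], [1], [2,2], [3,3,3], [4,4,4,4], [], [], [0,1,3], [0,2,3],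
    [0,1,4,4], [0,2,4,4], [0,3,4], [], [0,1,5,5,5], [0,2,5,5,5], [0,3,5,3,5], [0,4,5,4,5],
    [0,5,6,5,6], [], [0,1,3,4], [0,2], [0,1,4], [0,2,2,4], [0,1,3,4], [], [0,1,3,4],
    [0,2,2,5,5], [0,1,3,3,5], [0,1,4,4,5], [0,1,5,6,5,6], [], [0,2], [0,1,3], [0,2,3],
    [0,1,4,4], [0,2,4,4], [0,3,4], [0,1,5,5,5], [0,2,5,5,5], [0,3,5,3,5], [0,4,5,4,5], [],
    [0,1,2,6,6,6], [0,2,2,6,6,6], [0,3,3,3,6,6], [0,4,4,4,6,6], [0,5,5,5,6], [0,1,2,6,7,6,7],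
    [1,2], [0,3,3], [0,3,3], [1,2], [2], [3,3,3], [], [], [1], [2], [0,1,2,4], [2,2,2,4],
    [0,2,3], [0,1,2,4], [1], [2,2], [1,3], [0,4,2,4], [0,1,2,5,6], [0,1,2,5,5], [1,1,2,4],
    [0,1,3,5,5], [1,1,3,4], [1,1,4,4], [1,2,2,4,5], [1,3,3,4,5], [0,1,5,5,5], [0,2,2,5],
    [0,3,3,5], [0,1,4,5], [0,1,2,3,5], [1], [2,2,2,3,6,6], [3,3,3,3,6,6], [1,4,4,4],
    [0,5,5,5,5], [0,1,2,3,6,7], [], [1], [1,1,3], [1], [0,1,4,5], [0,1,2,4], [0,1,3,4],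
    [0,1,5,4,5], [0,1,2,5,5], [0,1,3,5,5], [0,1,4,5], [0,1,4,5], [1], [1,1,2,4,5], [1,1,3,4,5],
    [0,1,4,4], [0,1,5,5,5], [0,1,6,7,6,7], [0,1,3,4], [0,2,3,4], [0,3,3], [0,1,3,5,6],
    [0,2,3,5,6], [0,4,4,4], [0,1,4,5,6,6], [0,2,4,5,6,6], [0,1,5,3,4,6], [0,2,5,3,4,6],
    [0,3,5,3,5,6], [0,4,5,4,5,6], [0,1,6], [0,2,6], [0,3,6,3,6], [0,4,6,4,6], [0,5,6,5,6], [],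
    [0,1,3,4,5,6], [0,2,3,4,5,6], [0,3,3,3,5,6], [0,4,4,4,5,6], [0,5,5,5,5], [0,6,6,6,6,6],
    [0,1,2,3,4,7,8], [0,2,4,5,6,7], [1,2,4,5,6,7], [0,3,4,5,6,7,7], [1,3,4,5,6,7,7],
    [0,4,2,3,6,7], [1,4,2,3,6,7], [2,4,2,4,6,7], [3,4,3,4,6,7], [0,5,2,3,6,7,7],
    [1,5,2,3,6,7,7], [2,5,2,5,6,7,7], [3,5,3,5,6,7,7], [0,6], [1,6], [2,6,2,6], [3,6,3,6],
    [4,6,4,6,4,6], [5,6,5,6,5,6], [0,7,2,3,4,5,7], [1,7,2,3,4,5,7], [2,7,2,7,4,5,7],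
    [3,7,3,7,4,5,7], [4,7,4,7,4,7,7], [5,7,5,7,5,7,7], [0,2,3,4,5,6,7], [1,2,3,4,5,6,7],
    [2,2,2,4,5,6,7], [3,3,3,4,5,6,7], [4,4,4,4,4,6,7], [5,5,5,5,5,6,7], [6,6,6,6,6,6],
    [7,7,7,7,7,7,7], []]) (by decide +kernel)
-- Isomorphism invariants
/-- The number of vertices spanned by a set of edges. -/
def span (b : Finset (Finset ℕ)) : ℕ := (b.biUnion id).card

/-- The number of pairs of adjacent edges in a set of edges. -/
def numAdjacent (b : Finset (Finset ℕ)) : ℕ := {T ∈ powersetCard 2 b | span T = 3}.card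

/-- The number of ends of edges in `b` that lie on the edge `e`. -/
def weight (b : Finset (Finset ℕ)) (e : Finset ℕ) : ℕ := ∑ f ∈ b, (e ∩ f).card

/-- An invariant of graphs that separates the graphs with five edges. -/
def signature (b : Finset (Finset ℕ)) : ℕ × ℕ :=
  (span b, ∑ e ∈ b, ∑ f ∈ b, (e ∩ f).card * weight b e * weight b f)

theorem biUnion_relabel (σ : Perm ℕ) (b : Finset (Finset ℕ)) :
    (relabel σ b).biUnion id = (b.biUnion id).map σ.toEmbedding := by
  ext x
  simp only [relabel, mem_biUnion, Finset.mem_map, id]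
  constructor
  · rintro ⟨_, ⟨e, he, rfl⟩, hx⟩
    obtain ⟨y, hy, rfl⟩ := Finset.mem_map.1 hx
    exact ⟨y, ⟨e, he, hy⟩, rfl⟩
  · rintro ⟨y, ⟨e, he, hy⟩, rfl⟩
    exact ⟨_, ⟨e, he, rfl⟩, Finset.mem_map_of_mem _ hy⟩

theorem span_relabel (σ : Perm ℕ) (b : Finset (Finset ℕ)) : span (relabel σ b) = span b := by
  rw [span, biUnion_relabel, Finset.card_map, span]

theorem signature_relabel (σ : Perm ℕ) (b : Finset (Finset ℕ)) :
    signature (relabel σ b) = signature b := by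
  have hi : ∀ e f : Finset ℕ, (e.map σ.toEmbedding ∩ f.map σ.toEmbedding).card = (e ∩ f).card :=
    fun e f => by rw [← Finset.map_inter, Finset.card_map]
  have hw : ∀ e, weight (relabel σ b) (e.map σ.toEmbedding) = weight b e := fun e => by
    simp [weight, relabel, hi]
  rw [signature, span_relabel, signature, relabel]
  simp only [Finset.sum_map, RelEmbedding.coe_toEmbedding, Finset.mapEmbedding_apply, hi]
  simp only [← hw]
  rfl

/-- The graphs with five edges and no isolated vertices. -/
def graph (i : Fin 26) : Pattern := fiveEdgePatterns[i]

theorem graph_valid : ∀ i, (graph i).Valid := by decide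

/-- Shows that the 26 graphs are pairwise non-isomorphic, without a search through permutations. -/
theorem signature_graph_injective :
    Function.Injective fun i => signature (edgeSet (graph i).edges) := by
  decide +kernel

/-- The numbers of pairs of adjacent edges in the graphs with five edges. -/
def adjacencies (i : Fin 26) : ℕ :=
  [8, 8, 7, 6, 5, 4, 3, 10, 7, 6, 6, 6, 5, 5, 4, 4, 3, 4, 5, 4, 3, 3, 2, 2, 1, 0][i]

theorem numAdjacent_graph : ∀ i, numAdjacent (edgeSet (graph i).edges) = adjacencies i := by
  decide +kernel

end Pattern
-- The action on edges and the transfer to natural numbers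
/-- The edges of the complete graph on `n` vertices. -/
abbrev Edge (n : ℕ) : Type := Set.powersetCard (Fin n) 2

/-- The permutation of the edges induced by a permutation of the vertices. -/
def edgePerm {n : ℕ} (g : Perm (Fin n)) : Perm (Edge n) :=
  MulAction.toPermHom (Perm (Fin n)) (Edge n) g

theorem coe_edgePerm {n : ℕ} (g : Perm (Fin n)) (e : Edge n) :
    (edgePerm g e : Finset (Fin n)) = (e : Finset (Fin n)).map g.toEmbedding := by
  rw [Finset.map_eq_image]
  rfl

theorem mem_pairGroup {n : ℕ} {σ : Perm (Edge n)} : σ ∈ pairGroup n ↔ ∃ g, edgePerm g = σ :=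
  Iff.rfl

/-- The image of a set of edges under a permutation of the vertices. -/
def moveEdges {n : ℕ} (g : Perm (Fin n)) (c : Finset (Edge n)) : Finset (Edge n) :=
  c.map (edgePerm g).toEmbedding

theorem card_moveEdges {n : ℕ} (g : Perm (Fin n)) (c : Finset (Edge n)) :
    (moveEdges g c).card = c.card := Finset.card_map _

/-- An edge as a set of natural numbers. -/
def natEdge {n : ℕ} : Edge n ↪ Finset ℕ where
  toFun e := (e : Finset (Fin n)).map Fin.valEmbedding
  inj' := (Finset.map_injective _).comp Subtype.val_injective

/-- A set of edges as a set of sets of natural numbers. -/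
def natEdges {n : ℕ} (c : Finset (Edge n)) : Finset (Finset ℕ) := c.map natEdge

theorem natEdges_injective {n : ℕ} : Function.Injective (natEdges (n := n)) :=
  Finset.map_injective _

theorem natEdges_moveEdges_swap {n : ℕ} (i j : Fin n) (c : Finset (Edge n)) :
    natEdges (moveEdges (swap i j) c) = relabel (swap (i : ℕ) j) (natEdges c) := by
  simp only [natEdges, moveEdges, relabel, Finset.map_map]
  congr 1
  have hsw : ∀ a : Fin n, ((swap i j a : Fin n) : ℕ) = swap (i : ℕ) j a := fun a => by
    simp only [swap_apply_def, Fin.ext_iff]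
    split_ifs <;> rfl
  refine Function.Embedding.ext fun e => ?_
  change (edgePerm (swap i j) e : Finset (Fin n)).map Fin.valEmbedding =
    ((e : Finset (Fin n)).map Fin.valEmbedding).map (swap (i : ℕ) j).toEmbedding
  rw [coe_edgePerm, Finset.map_map, Finset.map_map]
  congr 1
  exact Function.Embedding.ext hsw

theorem map_natEdge_univ (n : ℕ) : (univ : Finset (Edge n)).map natEdge = completeEdges n := by
  ext e
  simp only [Finset.mem_map, mem_univ, true_and, completeEdges, mem_powersetCard]
  constructor
  · rintro ⟨e, rfl⟩
    refine ⟨fun x hx => ?_, by simp [natEdge]⟩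
    obtain ⟨y, -, rfl⟩ := Finset.mem_map.1 hx
    simp
  · rintro ⟨h, hc⟩
    have h' : ∀ m ∈ e, m < n := fun m hm => mem_range.1 (h hm)
    exact ⟨⟨e.attachFin h', by rw [Set.powersetCard.mem_iff, card_attachFin, hc]⟩,
      map_valEmbedding_attachFin h'⟩

theorem sum_natEdges (n m : ℕ) (F : Finset (Finset ℕ) → ℕ) :
    ∑ b ∈ powersetCard m (completeEdges n), F b =
      ∑ c ∈ powersetCard m (univ : Finset (Edge n)), F (natEdges c) := by
  rw [← map_natEdge_univ, powersetCard_map, Finset.sum_map]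
  rfl

/-- Invariance of a function on sets of edges under permutations of the vertices. -/
def IsInvariant {n : ℕ} (f : Finset (Edge n) → ℕ) : Prop :=
  ∀ (g : Perm (Fin n)) (c : Finset (Edge n)), f (moveEdges g c) = f c

/-- The transfer of a function to sets of sets of natural numbers. -/
noncomputable def natFun {n : ℕ} (f : Finset (Edge n) → ℕ) (b : Finset (Finset ℕ)) : ℕ :=
  ∑ c : Finset (Edge n), if natEdges c = b then f c else 0

theorem natFun_natEdges {n : ℕ} (f : Finset (Edge n) → ℕ) (c : Finset (Edge n)) :
    natFun f (natEdges c) = f c := by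
  simp [natFun, natEdges_injective.eq_iff]

/-- The transposition acts as an involution on edge sets, compatibly with `natEdges`; it permutes
the terms of the defining sum. -/
theorem swapInvariant_natFun {n : ℕ} {f : Finset (Edge n) → ℕ} (hf : IsInvariant f) :
    SwapInvariant n (natFun f) := by
  intro i hi j hj b
  have hinv : ∀ b, relabel (swap i j) (relabel (swap i j) b) = b := by
    intro b
    ext e
    simp only [relabel, Finset.map_map, Finset.mem_map]
    have : ∀ a : Finset ℕ, (a.map (swap i j).toEmbedding).map (swap i j).toEmbedding = a := by
      intro a
      ext x
      simp
    simp [this]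
  let g : Perm (Fin n) := swap ⟨i, hi⟩ ⟨j, hj⟩
  have hg : ∀ c, natEdges (moveEdges g c) = relabel (swap i j) (natEdges c) :=
    natEdges_moveEdges_swap _ _
  have hgg : ∀ c, moveEdges g (moveEdges g c) = c := fun c =>
    natEdges_injective (by rw [hg, hg, hinv])
  refine Finset.sum_bij' (fun c _ => moveEdges g c) (fun c _ => moveEdges g c) (by simp) (by simp)
    (fun c _ => hgg c) (fun c _ => hgg c) fun c _ => ?_
  rw [hf, hg]
  refine if_congr ⟨fun h => by rw [h, hinv], fun h => by rw [← h, hinv]⟩ rfl rfl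

/-- The copy of a pattern inside the complete graph on `n` vertices. -/
def Pattern.model (n : ℕ) (p : Pattern) : Finset (Edge n) :=
  {e | natEdge e ∈ edgeSet p.edges}

theorem Pattern.natEdges_model {n : ℕ} {p : Pattern} (hp : p.Valid) (h : p.order ≤ n) :
    natEdges (p.model n) = edgeSet p.edges := by
  ext e
  simp only [natEdges, Finset.mem_map, Pattern.model, mem_filter, mem_univ, true_and]
  constructor
  · rintro ⟨e, he, rfl⟩
    exact he
  · intro he
    obtain ⟨⟨i, j⟩, hij, rfl⟩ := mem_edgeSet.1 he
    have hv := hp _ hij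
    have : ({i, j} : Finset ℕ) ∈ (univ : Finset (Edge n)).map natEdge := by
      rw [map_natEdge_univ, completeEdges, mem_powersetCard]
      simp only at hv
      exact ⟨by intro x; simp; omega, Finset.card_pair hv.1.ne⟩
    obtain ⟨e, -, he'⟩ := Finset.mem_map.1 this
    exact ⟨e, he' ▸ he, he'⟩

/-- Tables are computed once over ℕ; this moves the identity to the edges of K_n for every n.
Patterns that do not fit have weight zero, so their truncated models do no harm. -/
theorem Pattern.Represents.sum_invariant {m : ℕ} {t : List Pattern} (h : Represents m t)
    (ht : ∀ p ∈ t, p.Valid) {n : ℕ} {f : Finset (Edge n) → ℕ} (hf : IsInvariant f) :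
    2 ^ m * m.factorial * ∑ c ∈ powersetCard m univ, f c =
      (t.map fun p => p.coeff * n.descFactorial p.order * f (p.model n)).sum := by
  have := h n _ (swapInvariant_natFun hf)
  simp only [sum_natEdges, natFun_natEdges] at this
  rw [this]
  refine congrArg List.sum (List.map_congr_left fun p hp => ?_)
  rcases lt_or_ge n p.order with hn | hn
  · simp [value, Nat.descFactorial_eq_zero_iff_lt.2 hn]
  · rw [value, ← natEdges_model (ht p hp) hn, natFun_natEdges]

open Pattern

theorem moveEdges_one {n : ℕ} (c : Finset (Edge n)) : moveEdges 1 c = c := by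
  have : edgePerm (1 : Perm (Fin n)) = 1 := map_one _
  rw [moveEdges, this]
  exact Finset.map_refl

theorem moveEdges_mul {n : ℕ} (g h : Perm (Fin n)) (c : Finset (Edge n)) :
    moveEdges (g * h) c = moveEdges g (moveEdges h c) := by
  have : edgePerm (g * h) = edgePerm g * edgePerm h := map_mul _ _ _
  rw [moveEdges, this, moveEdges, moveEdges, Finset.map_map]
  rfl

theorem moveEdges_inv {n : ℕ} (g : Perm (Fin n)) (c : Finset (Edge n)) :
    moveEdges g⁻¹ (moveEdges g c) = c := by
  rw [← moveEdges_mul, inv_mul_cancel, moveEdges_one]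

theorem moveEdges_subset {n : ℕ} (g : Perm (Fin n)) {c d : Finset (Edge n)} :
    moveEdges g c ⊆ moveEdges g d ↔ c ⊆ d := Finset.map_subset_map

/-- Closure of a set of edge sets under permutations of the vertices. -/
def IsClosed {n : ℕ} (B : Set (Finset (Edge n))) : Prop :=
  ∀ (g : Perm (Fin n)) (c : Finset (Edge n)), moveEdges g c ∈ B ↔ c ∈ B

theorem pairGroup_le_autGroup {n : ℕ} {B : Set (Finset (Edge n))} :
    pairGroup n ≤ autGroup B ↔ IsClosed B := by
  constructor
  · intro h g c
    have hg : mapBlocks (edgePerm g) B = B := h (mem_pairGroup.2 ⟨g, rfl⟩)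
    constructor
    · intro hc
      rw [← hg] at hc
      obtain ⟨d, hd, hdc⟩ := hc
      rwa [← Finset.map_injective _ hdc]
    · intro hc
      rw [← hg]
      exact ⟨c, hc, rfl⟩
  · rintro h σ hσ
    obtain ⟨g, rfl⟩ := mem_pairGroup.1 hσ
    change mapBlocks (edgePerm g) B = B
    ext c
    constructor
    · rintro ⟨d, hd, rfl⟩
      exact (h g d).2 hd
    · intro hc
      have := moveEdges_inv g⁻¹ c
      rw [inv_inv] at this
      exact ⟨moveEdges g⁻¹ c, (h _ _).2 hc, this⟩

/-- Transpositions generate the symmetric group, and for these `natEdges` is known to commute with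
relabelling. -/
theorem relabel_invariant_natEdges {n : ℕ} {α : Type*} {φ : Finset (Finset ℕ) → α}
    (hφ : ∀ σ b, φ (relabel σ b) = φ b) (g : Perm (Fin n)) :
    ∀ c, φ (natEdges (moveEdges g c)) = φ (natEdges c) := by
  induction g using Perm.swap_induction_on with
  | one => intro c; rw [moveEdges_one]
  | swap_mul g x y _ ih => intro c; rw [moveEdges_mul, natEdges_moveEdges_swap, hφ, ih]

/-! ### Invariant families as sets of graphs -/

/-- The number of labelled copies of a graph with five edges, counted with ordered and oriented
edges. -/
def copies (n : ℕ) (i : Fin 26) : ℕ := (graph i).coeff * n.descFactorial (graph i).order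

/-- The graph with index `i` on the vertices of the complete graph. -/
def copy (n : ℕ) (i : Fin 26) : Finset (Edge n) := (graph i).model n

/-- The graphs with five edges that fit into the complete graph on `n` vertices. -/
def fitting (n : ℕ) : Finset (Fin 26) := {i | (graph i).order ≤ n}

theorem mem_fitting {n : ℕ} {i : Fin 26} : i ∈ fitting n ↔ (graph i).order ≤ n := by
  simp [fitting]

theorem copies_eq_zero {n : ℕ} {i : Fin 26} (h : i ∉ fitting n) : copies n i = 0 := by
  rw [mem_fitting, not_le] at h
  rw [copies, Nat.descFactorial_eq_zero_iff_lt.2 h, mul_zero]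

theorem coeff_pos : ∀ i, 0 < (graph i).coeff := by decide

theorem copies_pos {n : ℕ} {i : Fin 26} (h : i ∈ fitting n) : 0 < copies n i := by
  rw [mem_fitting] at h
  exact Nat.mul_pos (coeff_pos i) (Nat.descFactorial_pos.2 h)

theorem natEdges_copy {n : ℕ} {i : Fin 26} (h : i ∈ fitting n) :
    natEdges (copy n i) = edgeSet (graph i).edges :=
  natEdges_model (graph_valid i) (mem_fitting.1 h)

theorem card_copy {n : ℕ} {i : Fin 26} (h : i ∈ fitting n) : (copy n i).card = 5 := by
  have h5 : ∀ i, (edgeSet (graph i).edges).card = 5 := by decide +kernel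
  rw [← h5 i, ← natEdges_copy h, natEdges, Finset.card_map]

/-- Here 3840 = 2^5 · 5! counts the orders and orientations of five edges. -/
theorem sum_five {n : ℕ} {f : Finset (Edge n) → ℕ} (hf : IsInvariant f) :
    3840 * ∑ c ∈ powersetCard 5 univ, f c = ∑ i, copies n i * f (copy n i) := by
  have := represents_fiveEdgePatterns.sum_invariant (by decide) hf
  rw [← Fin.sum_univ_getElem] at this
  exact this

/-- Completeness of the list. The indicator of the orbit of `c` is invariant with positive sum, so
by `sum_five` it cannot vanish at all fitting copies. -/
theorem exists_copy {n : ℕ} {c : Finset (Edge n)} (hc : c.card = 5) :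
    ∃ i ∈ fitting n, ∃ g, moveEdges g (copy n i) = c := by
  classical
  let f : Finset (Edge n) → ℕ := fun d => if ∃ g, moveEdges g d = c then 1 else 0
  have hf : IsInvariant f := by
    intro g d
    refine if_congr ⟨?_, ?_⟩ rfl rfl
    · rintro ⟨h, hh⟩
      exact ⟨h * g, by rw [moveEdges_mul, hh]⟩
    · rintro ⟨h, hh⟩
      exact ⟨h * g⁻¹, by rw [moveEdges_mul, moveEdges_inv, hh]⟩
  by_contra! hno
  have h0 : ∑ i, copies n i * f (copy n i) = 0 := by
    refine Finset.sum_eq_zero fun i _ => ?_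
    by_cases hi : i ∈ fitting n
    · have : ¬ ∃ g, moveEdges g (copy n i) = c := fun ⟨g, hg⟩ => hno i hi g hg
      simp [f, this]
    · rw [copies_eq_zero hi, zero_mul]
  rw [← sum_five hf] at h0
  have h1 := (Finset.sum_eq_zero_iff.1 (by simpa using h0 :
    ∑ c ∈ powersetCard 5 univ, f c = 0)) c (by simp [mem_powersetCard, hc])
  have : ∃ g, moveEdges g c = c := ⟨1, moveEdges_one c⟩
  simp [f, this] at h1

theorem copy_inj {n : ℕ} {i j : Fin 26} (hi : i ∈ fitting n) (hj : j ∈ fitting n)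
    {g : Perm (Fin n)} (h : moveEdges g (copy n i) = copy n j) : i = j := by
  apply signature_graph_injective
  have := relabel_invariant_natEdges signature_relabel g (copy n i)
  rw [h, natEdges_copy hi, natEdges_copy hj] at this
  exact this.symm

/-- The sets of edges that are isomorphic to a graph in `S`. -/
def family (n : ℕ) (S : Finset (Fin 26)) : Set (Finset (Edge n)) :=
  {b | ∃ i ∈ S, ∃ g, moveEdges g (copy n i) = b}

open Classical in
/-- The graphs whose copies belong to `B`. -/
noncomputable def graphsOf {n : ℕ} (B : Set (Finset (Edge n))) : Finset (Fin 26) :=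
  {i ∈ fitting n | copy n i ∈ B}

theorem isClosed_family (n : ℕ) (S : Finset (Fin 26)) : IsClosed (family n S) := by
  intro g c
  constructor
  · rintro ⟨i, hi, h, hh⟩
    exact ⟨i, hi, g⁻¹ * h, by rw [moveEdges_mul, hh, moveEdges_inv]⟩
  · rintro ⟨i, hi, h, hh⟩
    exact ⟨i, hi, g * h, by rw [moveEdges_mul, hh]⟩

theorem card_of_mem_family {n : ℕ} {S : Finset (Fin 26)} (hS : S ⊆ fitting n)
    {b : Finset (Edge n)} (hb : b ∈ family n S) : b.card = 5 := by
  obtain ⟨i, hi, g, rfl⟩ := hb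
  rw [card_moveEdges, card_copy (hS hi)]

theorem graphsOf_subset {n : ℕ} (B : Set (Finset (Edge n))) : graphsOf B ⊆ fitting n := by
  classical exact Finset.filter_subset _ _

theorem mem_graphsOf {n : ℕ} {B : Set (Finset (Edge n))} {i : Fin 26} :
    i ∈ graphsOf B ↔ i ∈ fitting n ∧ copy n i ∈ B := by
  simp [graphsOf]

theorem family_graphsOf {n : ℕ} {B : Set (Finset (Edge n))} (hB : IsClosed B)
    (hu : ∀ b ∈ B, b.card = 5) : family n (graphsOf B) = B := by
  ext b
  constructor
  · rintro ⟨i, hi, g, rfl⟩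
    exact (hB _ _).2 (mem_graphsOf.1 hi).2
  · intro hb
    obtain ⟨i, hi, g, rfl⟩ := exists_copy (hu b hb)
    exact ⟨i, mem_graphsOf.2 ⟨hi, (hB _ _).1 hb⟩, g, rfl⟩

theorem graphsOf_family {n : ℕ} {S : Finset (Fin 26)} (hS : S ⊆ fitting n) :
    graphsOf (family n S) = S := by
  ext i
  rw [mem_graphsOf]
  constructor
  · rintro ⟨hi, j, hj, g, hg⟩
    rwa [← copy_inj (hS hj) hi hg]
  · intro hi
    exact ⟨hS hi, i, hi, 1, moveEdges_one _⟩

/-! ### Double counting and the balance equations -/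

/-- The number of members of `B` that contain `T`. -/
noncomputable def degree {n : ℕ} (B : Set (Finset (Edge n))) (T : Finset (Edge n)) : ℕ :=
  {b ∈ B | T ⊆ b}.ncard

theorem isInvariant_degree {n : ℕ} {B : Set (Finset (Edge n))} (hB : IsClosed B) :
    IsInvariant (degree B) := by
  intro g T
  have : {b ∈ B | moveEdges g T ⊆ b} = moveEdges g '' {b ∈ B | T ⊆ b} := by
    ext b
    constructor
    · rintro ⟨hb, hT⟩
      have hb' := moveEdges_inv g⁻¹ b
      rw [inv_inv] at hb'
      refine ⟨moveEdges g⁻¹ b, ⟨(hB _ _).2 hb, ?_⟩, hb'⟩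
      rwa [← moveEdges_subset g, hb']
    · rintro ⟨c, ⟨hc, hT⟩, rfl⟩
      exact ⟨(hB _ _).2 hc, (moveEdges_subset g).2 hT⟩
  rw [degree, this, Set.ncard_image_of_injective (f := moveEdges g) _ (Finset.map_injective _), degree]

open Classical in
theorem degree_eq_sum {n : ℕ} {B : Set (Finset (Edge n))} (hu : ∀ b ∈ B, b.card = 5)
    (T : Finset (Edge n)) : degree B T =
      ∑ b ∈ powersetCard 5 univ, if b ∈ B ∧ T ⊆ b then 1 else 0 := by
  rw [degree, ← Finset.sum_filter, ← Finset.card_eq_sum_ones, ← Set.ncard_coe_finset]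
  congr 1
  ext b
  simp only [Set.mem_ofPred_eq, coe_filter, mem_powersetCard, subset_univ, true_and]
  exact ⟨fun h => ⟨hu b h.1, h⟩, fun h => h.2⟩

/-- The total number of copies of the graphs in `S`. -/
def mass (n : ℕ) (S : Finset (Fin 26)) : ℕ := ∑ i ∈ S, copies n i

/-- The total number of adjacent pairs in copies of the graphs in `S`. -/
def adjacentMass (n : ℕ) (S : Finset (Fin 26)) : ℕ := ∑ i ∈ S, copies n i * adjacencies i

/-- Two adjacent edges. -/
def adjacentPair (n : ℕ) : Finset (Edge n) := model n ⟨4, 3, [(0, 1), (0, 2)]⟩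

/-- Two disjoint edges. -/
def disjointPair (n : ℕ) : Finset (Edge n) := model n ⟨1, 4, [(0, 1), (2, 3)]⟩

theorem sum_two {n : ℕ} {f : Finset (Edge n) → ℕ} (hf : IsInvariant f) :
    8 * ∑ c ∈ powersetCard 2 univ, f c = 4 * n.descFactorial 3 * f (adjacentPair n) +
      n.descFactorial 4 * f (disjointPair n) := by
  have := represents_twoEdgePatterns.sum_invariant (by decide) hf
  simpa [twoEdgePatterns, adjacentPair, disjointPair] using this

theorem span_adjacentPair {n : ℕ} (hn : 4 ≤ n) : span (natEdges (adjacentPair n)) = 3 := by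
  rw [adjacentPair, natEdges_model (by decide) (by simp only; omega)]
  decide

theorem span_disjointPair {n : ℕ} (hn : 4 ≤ n) : span (natEdges (disjointPair n)) = 4 := by
  rw [disjointPair, natEdges_model (by decide) (by simp only; omega)]
  decide

open Classical in
theorem sum_mul_graphsOf {n : ℕ} (B : Set (Finset (Edge n))) (h : Fin 26 → ℕ) :
    ∑ i, copies n i * (if copy n i ∈ B then h i else 0) = ∑ i ∈ graphsOf B, copies n i * h i := by
  rw [← Finset.sum_subset (Finset.subset_univ (graphsOf B))]
  · exact Finset.sum_congr rfl fun i hi => by rw [if_pos (mem_graphsOf.1 hi).2]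
  · intro i _ hi
    by_cases hf : i ∈ fitting n
    · rw [if_neg fun h => hi (mem_graphsOf.2 ⟨hf, h⟩), mul_zero]
    · rw [copies_eq_zero hf, zero_mul]

open Classical in
-- Counts the pairs `T ⊆ b` with `P T` in two ways. It is used for adjacent pairs and for all pairs.
theorem sum_weighted_degree {n : ℕ} {B : Set (Finset (Edge n))}
    (hu : ∀ b ∈ B, b.card = 5) (P : Finset (Edge n) → Prop)
    [DecidablePred P] :
    ∑ T ∈ powersetCard 2 univ, (if P T then degree B T else 0) =
      ∑ b ∈ powersetCard 5 univ, if b ∈ B then {T ∈ powersetCard 2 b | P T}.card else 0 := by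
  have h1 : ∀ T, (if P T then degree B T else 0) =
      ∑ b ∈ powersetCard 5 univ, if b ∈ B ∧ T ⊆ b ∧ P T then 1 else 0 := by
    intro T
    by_cases h : P T <;> simp [h, degree_eq_sum hu]
  simp only [h1]
  rw [Finset.sum_comm]
  refine Finset.sum_congr rfl fun b _ => ?_
  by_cases hb : b ∈ B
  · simp only [hb, true_and, if_true]
    rw [← Finset.sum_filter, ← Finset.card_eq_sum_ones]
    congr 1
    ext T
    simp only [mem_filter, mem_powersetCard, subset_univ, true_and]
    tauto
  · simp [hb]

theorem card_filter_span {n : ℕ} (b : Finset (Edge n)) :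
    {T ∈ powersetCard 2 b | span (natEdges T) = 3}.card = numAdjacent (natEdges b) := by
  rw [numAdjacent, natEdges, powersetCard_map, Finset.filter_map, Finset.card_map]
  rfl

/-- Count incidences of blocks with adjacent pairs. The factor is 1920 = 3840 · 4 / 8, from
`sum_five` and `sum_two`. -/
theorem adjacentMass_eq {n : ℕ} (hn : 4 ≤ n) {B : Set (Finset (Edge n))} (hB : IsClosed B)
    (hu : ∀ b ∈ B, b.card = 5) :
    adjacentMass n (graphsOf B) = 1920 * n.descFactorial 3 * degree B (adjacentPair n) := by
  classical
  have h2 := sum_two (f := fun T => if span (natEdges T) = 3 then degree B T else 0) (n := n)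
    fun g T => by
      simp only [isInvariant_degree hB g T, relabel_invariant_natEdges span_relabel g T]
  have hc := sum_weighted_degree hu fun T => span (natEdges T) = 3
  have h5 := sum_five (f := fun b => if b ∈ B then numAdjacent (natEdges b) else 0) (n := n)
    fun g b => by
      have : numAdjacent (natEdges (moveEdges g b)) = numAdjacent (natEdges b) := by
        simp only [← card_filter_span]
        rw [moveEdges, powersetCard_map, Finset.filter_map, Finset.card_map]
        congr 1
        refine Finset.filter_congr fun T _ => ?_
        exact Eq.congr_left (relabel_invariant_natEdges span_relabel g T)
      simp only [this, hB g b]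
  simp only [card_filter_span] at hc
  rw [span_adjacentPair hn, span_disjointPair hn, hc] at h2
  have hA : ∑ i, copies n i * (if copy n i ∈ B then numAdjacent (natEdges (copy n i)) else 0) =
      ∑ i, copies n i * (if copy n i ∈ B then adjacencies i else 0) := by
    refine Finset.sum_congr rfl fun i _ => ?_
    by_cases hf : i ∈ fitting n
    · rw [natEdges_copy hf, numAdjacent_graph]
    · rw [copies_eq_zero hf, zero_mul, zero_mul]
  rw [hA, sum_mul_graphsOf] at h5
  rw [if_pos rfl, if_neg (by norm_num), mul_zero, add_zero] at h2
  rw [adjacentMass]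
  linarith

/-- Count incidences of blocks with all pairs. A block has ten pairs, whence the factor 48 = 3840 /
(8 · 10). -/
theorem mass_eq {n : ℕ} {B : Set (Finset (Edge n))} (hB : IsClosed B)
    (hu : ∀ b ∈ B, b.card = 5) :
    mass n (graphsOf B) = 48 * (4 * n.descFactorial 3 * degree B (adjacentPair n) +
      n.descFactorial 4 * degree B (disjointPair n)) := by
  classical
  have h2 := sum_two (isInvariant_degree hB)
  have hc := sum_weighted_degree hu fun _ => True
  have h5 := sum_five (f := fun b => if b ∈ B then 1 else 0) (n := n) fun g b => by
    simp only [hB g b]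
  rw [sum_mul_graphsOf B fun _ => 1] at h5
  have h10 : ∑ b ∈ powersetCard 5 (univ : Finset (Edge n)),
      (if b ∈ B then {T ∈ powersetCard 2 b | True}.card else 0) =
      10 * ∑ b ∈ powersetCard 5 (univ : Finset (Edge n)), if b ∈ B then 1 else 0 := by
    rw [Finset.mul_sum]
    refine Finset.sum_congr rfl fun b hb => ?_
    have : (b.card.choose 2) = 10 := by rw [(mem_powersetCard.1 hb).2]; rfl
    simp [card_powersetCard, this]
  rw [h10] at hc
  simp only [if_true] at hc
  simp only [mul_one] at h5
  rw [mass]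
  linarith

/-- The mass of a family of index one. -/
def unitMass (n : ℕ) : ℕ := 48 * n.descFactorial 3 * (n + 1)

/-- Balance means that both pair degrees equal `lam`. By the two counting identities this is
equivalent to prescribing the average adjacency 40/(n+1) and the total mass. -/
theorem balanced_iff {n : ℕ} (hn : 4 ≤ n) {B : Set (Finset (Edge n))} (hB : IsClosed B)
    (hu : ∀ b ∈ B, b.card = 5) (lam : ℕ) :
    (∀ T : Finset (Edge n), T.card = 2 → {b ∈ B | T ⊆ b}.ncard = lam) ↔
      (n + 1) * adjacentMass n (graphsOf B) = 40 * mass n (graphsOf B) ∧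
        mass n (graphsOf B) = unitMass n * lam := by
  classical
  have hA := adjacentMass_eq hn hB hu
  have hM := mass_eq hB hu
  obtain ⟨m, rfl⟩ := Nat.exists_eq_add_of_le' hn
  have h4 : (m + 4).descFactorial 4 = (m + 1) * (m + 4).descFactorial 3 := by
    rw [Nat.descFactorial_succ]; rfl
  rw [h4] at hM
  have h3 : 0 < (m + 4).descFactorial 3 := Nat.descFactorial_pos.2 (by omega)
  have key : (∀ T : Finset (Edge (m + 4)), T.card = 2 → {b ∈ B | T ⊆ b}.ncard = lam) ↔
      degree B (adjacentPair (m + 4)) = lam ∧ degree B (disjointPair (m + 4)) = lam := by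
    constructor
    · intro h
      have hcard : ∀ p : Pattern, p.Valid → p.order ≤ m + 4 →
          (edgeSet p.edges).card = 2 → (p.model (m + 4)).card = 2 := fun p h1 h2 h3 => by
        rw [← h3, ← natEdges_model h1 h2, natEdges, Finset.card_map]
      exact ⟨h _ (hcard _ (by decide) (by simp only; omega) (by decide)),
        h _ (hcard _ (by decide) (by simp only; omega) (by decide))⟩
    · rintro ⟨h1, h2⟩ T hT
      -- The indicator of a wrong degree vanishes on both orbit representatives, hence on all pairs.
      have := sum_two (f := fun T => if degree B T = lam then 0 else 1) (n := m + 4) fun g T => by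
        simp only [isInvariant_degree hB g T]
      simp only [h1, h2, if_true, mul_zero, add_zero, mul_eq_zero] at this
      have := (Finset.sum_eq_zero_iff.1 (this.resolve_left (by norm_num))) T
        (by simp [mem_powersetCard, hT])
      by_contra hne
      exact absurd this (by rw [if_neg (show ¬ degree B T = lam from hne)]; norm_num)
  rw [key, hA, hM, unitMass]
  set d := (m + 4).descFactorial 3
  set x := degree B (adjacentPair (m + 4))
  set y := degree B (disjointPair (m + 4))
  constructor
  · rintro ⟨hx, hy⟩
    rw [hx, hy]
    constructor <;> ring
  · rintro ⟨e1, e2⟩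
    -- Substituting the mass into the first equation eliminates `y`, since 1920 = 48 · 40.
    have e3 : (48 * d * (m + 5)) * (40 * x) = (48 * d * (m + 5)) * (40 * lam) := by
      linarith
    have hx : x = lam := by
      have := Nat.eq_of_mul_eq_mul_left (by positivity) e3
      omega
    refine ⟨hx, ?_⟩
    rw [hx] at e2
    have e4 : (48 * d * (m + 1)) * y = (48 * d * (m + 1)) * lam := by linarith
    exact Nat.eq_of_mul_eq_mul_left (by positivity) e4

/-! ### The normalizer of the group on edges -/

theorem span_natEdges_pair {n : ℕ} {e f : Edge n} (h : e ≠ f) :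
    span (natEdges {e, f}) = 3 ↔ ¬ Disjoint (e : Finset (Fin n)) f := by
  have h1 : span (natEdges {e, f}) = ((e : Finset (Fin n)) ∪ f).card := by
    rw [span, natEdges, ← Finset.card_map Fin.valEmbedding, Finset.map_union]
    congr 1
    ext x
    simp [natEdge]
  have h2 := Finset.card_union_add_card_inter (e : Finset (Fin n)) f
  rw [Set.powersetCard.card_eq e, Set.powersetCard.card_eq f] at h2
  have h3 : ((e : Finset (Fin n)) ∩ f).card < 2 := by
    by_contra! hc
    have he := Finset.eq_of_subset_of_card_le (Finset.inter_subset_left (s₁ := (e : Finset (Fin n)))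
      (s₂ := f)) (by rw [Set.powersetCard.card_eq e]; exact hc)
    exact h (Set.powersetCard.eq_iff_subset.2 (he ▸ Finset.inter_subset_right))
  rw [h1, Finset.disjoint_iff_inter_eq_empty, ← Finset.card_eq_zero]
  omega

/-- Adjacent pairs form a single orbit, and a normalizing `σ` maps orbits to orbits; hence all
adjacent pairs have images of the same type. -/
theorem adjacent_or_disjoint {n : ℕ} (hn : 4 ≤ n) {σ : Perm (Edge n)}
    (hσ : ∀ g : Perm (Fin n), ∃ g' : Perm (Fin n), ∀ e, σ (edgePerm g e) = edgePerm g' (σ e)) :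
    (∀ e f : Edge n, e ≠ f → ¬ Disjoint (e : Finset (Fin n)) f →
      ¬ Disjoint (σ e : Finset (Fin n)) (σ f)) ∨
    (∀ e f : Edge n, e ≠ f → ¬ Disjoint (e : Finset (Fin n)) f →
      Disjoint (σ e : Finset (Fin n)) (σ f)) := by
  let Q : Finset (Edge n) → ℕ := fun T => span (natEdges (T.map σ.toEmbedding))
  have hQ : ∀ (g : Perm (Fin n)) T, Q (moveEdges g T) = Q T := by
    intro g T
    obtain ⟨g', hg'⟩ := hσ g
    have : (moveEdges g T).map σ.toEmbedding = moveEdges g' (T.map σ.toEmbedding) := by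
      simp only [moveEdges, Finset.map_map]
      congr 1
      exact Function.Embedding.ext hg'
    simp only [Q, this, relabel_invariant_natEdges span_relabel]
  -- A property of `Q` that fails at one adjacent pair fails at all: the test function vanishes on
  -- both representatives.
  have key : ∀ P : ℕ → Prop, ¬ P (Q (adjacentPair n)) → ∀ e f : Edge n, e ≠ f →
      ¬ Disjoint (e : Finset (Fin n)) f → ¬ P (Q {e, f}) := by
    classical
    intro P hP e f hne hef hPe
    have := sum_two (f := fun T => if span (natEdges T) = 3 ∧ P (Q T) then 1 else 0) (n := n)
      fun g T => by simp only [relabel_invariant_natEdges span_relabel, hQ]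
    rw [if_neg fun h => hP h.2, span_disjointPair hn, if_neg fun h => by omega, mul_zero,
      mul_zero, add_zero, mul_eq_zero] at this
    have := (Finset.sum_eq_zero_iff.1 (this.resolve_left (by norm_num)))
      {e, f} (by simp [mem_powersetCard, Finset.card_pair hne])
    simp [(span_natEdges_pair hne).2 hef, hPe] at this
  have hpair : ∀ e f : Edge n, e ≠ f →
      (Q {e, f} = 3 ↔ ¬ Disjoint (σ e : Finset (Fin n)) (σ f)) := by
    intro e f hne
    rw [← span_natEdges_pair (σ.injective.ne hne)]
    simp [Q, Finset.map_insert]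
  by_cases h : Q (adjacentPair n) = 3
  · left
    intro e f hne hef
    rw [← hpair e f hne]
    exact not_not.1 (key (· ≠ 3) (not_not.2 h) e f hne hef)
  · right
    intro e f hne hef
    have := key (· = 3) h e f hne hef
    rw [hpair e f hne] at this
    exact not_not.1 this

/-- The edges through a vertex. -/
def star {n : ℕ} (a : Fin n) : Finset (Edge n) := {e | a ∈ (e : Finset (Fin n))}

theorem mem_star {n : ℕ} {a : Fin n} {e : Edge n} : e ∈ star a ↔ a ∈ (e : Finset (Fin n)) := by
  simp [star]

theorem card_star {n : ℕ} (a : Fin n) : (star a).card = n - 1 := by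
  have : (univ.erase a).card = n - 1 := by simp
  rw [← this]
  symm
  refine Finset.card_bij (fun j hj => ⟨{a, j}, by
    rw [Set.powersetCard.mem_iff, Finset.card_pair (Finset.ne_of_mem_erase hj).symm]⟩) ?_ ?_ ?_
  · intro j hj
    simp [mem_star]
  · intro i hi j hj h
    have h' : ({a, i} : Finset (Fin n)) = {a, j} := congrArg Subtype.val h
    have : i ∈ ({a, j} : Finset (Fin n)) := h' ▸ by simp
    simpa [Finset.ne_of_mem_erase hi] using this
  · intro e he
    rw [mem_star] at he
    obtain ⟨x, y, hxy, h⟩ := Finset.card_eq_two.1 (Set.powersetCard.card_eq e)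
    rw [h] at he
    rcases Finset.mem_insert.1 he with rfl | he
    · exact ⟨y, by simp [hxy.symm], Subtype.ext h.symm⟩
    · rw [Finset.mem_singleton] at he
      subst he
      exact ⟨x, by simp [hxy], Subtype.ext ((Finset.pair_comm _ _).trans h.symm)⟩

/-- Pairwise intersecting edges form part of a star or of a triangle, and a triangle has only three
edges. -/
theorem exists_common_vertex {n : ℕ} {s : Finset (Edge n)} (hs : 4 ≤ s.card)
    (h : ∀ e ∈ s, ∀ f ∈ s, e ≠ f → ¬ Disjoint (e : Finset (Fin n)) f) :
    ∃ a, s ⊆ star a := by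
  obtain ⟨e, he, f, hf, hef⟩ := Finset.one_lt_card.1 (by omega : 1 < s.card)
  have hi : ∀ e ∈ s, ∀ f ∈ s, ∃ x, x ∈ (e : Finset (Fin n)) ∧ x ∈ (f : Finset (Fin n)) := by
    intro e he f hf
    by_cases hef : e = f
    · subst hef
      obtain ⟨x, hx⟩ := Finset.card_pos.1 (by rw [Set.powersetCard.card_eq e]; norm_num :
        0 < (e : Finset (Fin n)).card)
      exact ⟨x, hx, hx⟩
    · exact Finset.not_disjoint_iff.1 (h e he f hf hef)
  have h2 : ∀ (e : Edge n) x, x ∈ (e : Finset (Fin n)) →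
      ∃ y, y ≠ x ∧ (e : Finset (Fin n)) = {x, y} := by
    intro e x hx
    obtain ⟨a, b, hab, h⟩ := Finset.card_eq_two.1 (Set.powersetCard.card_eq e)
    rw [h] at hx
    rcases Finset.mem_insert.1 hx with rfl | hx
    · exact ⟨b, hab.symm, h⟩
    · rw [Finset.mem_singleton] at hx
      subst hx
      exact ⟨a, hab, by rw [h, Finset.pair_comm]⟩
  obtain ⟨x, hxe, hxf⟩ := hi e he f hf
  obtain ⟨y, hy, hey⟩ := h2 e x hxe
  obtain ⟨z, hz, hfz⟩ := h2 f x hxf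
  have hyz : y ≠ z := fun hyz => hef (Subtype.ext (by rw [hey, hfz, hyz]))
  refine ⟨x, fun k hk => mem_star.2 ?_⟩
  by_contra hxk
  have meet : ∀ k ∈ s, ∀ l ∈ s, ∀ p q, (l : Finset (Fin n)) = {p, q} →
      p ∈ (k : Finset (Fin n)) ∨ q ∈ (k : Finset (Fin n)) := by
    intro k hk l hl p q hpq
    obtain ⟨w, hw, hw'⟩ := hi k hk l hl
    rw [hpq] at hw'
    rcases Finset.mem_insert.1 hw' with rfl | hw'
    · exact Or.inl hw
    · rw [Finset.mem_singleton] at hw'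
      exact Or.inr (hw' ▸ hw)
  have two : ∀ (k : Edge n) p q, p ≠ q → p ∈ (k : Finset (Fin n)) → q ∈ (k : Finset (Fin n)) →
      (k : Finset (Fin n)) = {p, q} := by
    intro k p q hpq hp hq
    refine (Finset.eq_of_subset_of_card_le ?_ ?_).symm
    · simp [Finset.insert_subset_iff, hp, hq]
    · rw [Set.powersetCard.card_eq k, Finset.card_pair hpq]
  have hky := (meet k hk e he x y hey).resolve_left hxk
  have hkz := (meet k hk f hf x z hfz).resolve_left hxk
  have hkyz := two k y z hyz hky hkz
  -- With `k` avoiding `x`, the edges `e`, `f`, `k` form the triangle `x y z`, and no other edge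
  -- meets all three.
  have hsub : s ⊆ {e, f, k} := by
    intro l hl
    have h1 := meet l hl e he x y hey
    have h2 := meet l hl f hf x z hfz
    have h3 := meet l hl k hk y z hkyz
    simp only [Finset.mem_insert, Finset.mem_singleton]
    by_cases hx : x ∈ (l : Finset (Fin n))
    · rcases h3 with hy' | hz'
      · exact Or.inl (Subtype.ext (by rw [hey, two l x y hy.symm hx hy']))
      · exact Or.inr (Or.inl (Subtype.ext (by rw [hfz, two l x z hz.symm hx hz'])))
    · exact Or.inr (Or.inr (Subtype.ext (by
        rw [hkyz, two l y z hyz (h1.resolve_left hx) (h2.resolve_left hx)])))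
  have := (Finset.card_le_card hsub).trans Finset.card_le_three
  omega

/-- If `σ` preserves adjacency, it maps stars to stars and so induces a vertex permutation that in
turn induces `σ`. The alternative would give n − 1 pairwise disjoint edges on n vertices. The bound
`5 ≤ n` makes stars have at least four edges. -/
theorem mem_pairGroup_of_normalizes {n : ℕ} (hn : 5 ≤ n) {σ : Perm (Edge n)}
    (hσ : ∀ g : Perm (Fin n), ∃ g' : Perm (Fin n), ∀ e, σ (edgePerm g e) = edgePerm g' (σ e)) :
    σ ∈ pairGroup n := by
  have hcard : ∀ a : Fin n, ((star a).map σ.toEmbedding).card = n - 1 := fun a => by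
    rw [Finset.card_map, card_star]
  have hmeet : ∀ a : Fin n, ∀ e ∈ star a, ∀ f ∈ star a, ¬ Disjoint (e : Finset (Fin n)) f :=
    fun a e he f hf => Finset.not_disjoint_iff.2 ⟨a, mem_star.1 he, mem_star.1 hf⟩
  rcases adjacent_or_disjoint (by omega) hσ with h | h
  · have hstar : ∀ a : Fin n, ∃ b : Fin n, (star a).map σ.toEmbedding = star b := by
      intro a
      obtain ⟨b, hb⟩ := exists_common_vertex (s := (star a).map σ.toEmbedding)
        (by rw [hcard]; omega) (by
          intro e he f hf hef
          obtain ⟨e, he', rfl⟩ := Finset.mem_map.1 he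
          obtain ⟨f, hf', rfl⟩ := Finset.mem_map.1 hf
          exact h e f (fun h => hef (congrArg _ h)) (hmeet a e he' f hf'))
      exact ⟨b, Finset.eq_of_subset_of_card_le hb (by rw [hcard, card_star])⟩
    choose τ hτ using hstar
    have hinj : Function.Injective τ := by
      intro a b hab
      by_contra hne
      have hs : star a = star b := Finset.map_injective σ.toEmbedding (by rw [hτ, hτ, hab])
      -- For a third vertex `c`, the edge {a, c} lies in the star of `a` but not in that of `b`.
      obtain ⟨c, hc⟩ := Finset.exists_mem_notMem_of_card_lt_card
        (s := {a, b}) (t := (univ : Finset (Fin n))) (by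
          rw [Finset.card_pair hne, Finset.card_univ, Fintype.card_fin]; omega)
      simp only [mem_univ, Finset.mem_insert, Finset.mem_singleton, not_or, true_and] at hc
      have : (⟨{a, c}, by rw [Set.powersetCard.mem_iff, Finset.card_pair (Ne.symm hc.1)]⟩ :
        Edge n) ∈ star b := hs ▸ mem_star.2 (by simp)
      rw [mem_star] at this
      simp only [Finset.mem_insert, Finset.mem_singleton] at this
      rcases this with h | h
      · exact hne h.symm
      · exact hc.2 h.symm
    let g : Perm (Fin n) := Equiv.ofBijective τ (Finite.injective_iff_bijective.1 hinj)
    refine mem_pairGroup.2 ⟨g, Equiv.ext fun e => Subtype.ext ?_⟩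
    rw [coe_edgePerm]
    refine Finset.eq_of_subset_of_card_le ?_ (by
      rw [Finset.card_map, Set.powersetCard.card_eq e, Set.powersetCard.card_eq (σ e)])
    intro x hx
    obtain ⟨a, ha, rfl⟩ := Finset.mem_map.1 hx
    have : σ e ∈ star (τ a) := hτ a ▸ Finset.mem_map_of_mem σ.toEmbedding (mem_star.2 ha)
    exact mem_star.1 this
  · exfalso
    let a : Fin n := ⟨0, by omega⟩
    -- The images of the edges of one star would be disjoint and cover 2(n − 1) > n vertices.
    have hd := Finset.card_biUnion (s := star a) (t := fun e => (σ e : Finset (Fin n)))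
      fun e he f hf hef => h e f hef (hmeet a e he f hf)
    have hle := Finset.card_le_univ ((star a).biUnion fun e => (σ e : Finset (Fin n)))
    rw [hd, Finset.sum_congr rfl fun e _ => Set.powersetCard.card_eq (σ e), Finset.sum_const, card_star,
      Fintype.card_fin, smul_eq_mul] at hle
    omega

/-! ### Subset sums by merging tallies -/

theorem ble_iff {a b : ℕ} : Nat.ble a b = true ↔ a ≤ b :=
  ⟨Nat.le_of_ble_eq_true, Nat.ble_eq_true_of_le⟩

theorem blt_iff {a b : ℕ} : Nat.blt a b = true ↔ a < b := ble_iff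

/-- A list of values with multiplicities. -/
inductive Tally
  | nil
  | cons (value mult : ℕ) (rest : Tally)

namespace Tally

/-- The sum of `f` over a tally. -/
def sum (f : ℕ → ℕ) : Tally → ℕ
  | nil => 0
  | cons z c t => c * f z + sum f t

/-- Put a value in front of a tally if it lies in the interval from `lo` to `hi`. -/
noncomputable def keep (lo hi z c : ℕ) (t : Tally) : Tally :=
  Bool.rec t (Bool.rec t (cons z c t) (Nat.blt z hi)) (Nat.ble lo z)

/-- Add `u` to the values in `s` and `v` to those in `t`, merge the resulting tallies in increasing
order, and keep the values from `lo` to `hi`. The recursors are used for fast evaluation. -/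
noncomputable def merge (u v lo hi : ℕ) (s : Tally) : Tally → Tally :=
  Tally.rec (motive := fun _ => Tally → Tally)
    (fun t => Tally.rec nil (fun z c _ ih => keep lo hi (Nat.add v z) c ih) t)
    (fun z c _ ih t =>
      Tally.rec (keep lo hi (Nat.add u z) c (ih nil))
        (fun z' c' t' ih' =>
          Bool.rec
            (Bool.rec (keep lo hi (Nat.add u z) (Nat.add c c') (ih t'))
              (keep lo hi (Nat.add u z) c (ih (cons z' c' t')))
              (Nat.blt (Nat.add u z) (Nat.add v z')))
            (keep lo hi (Nat.add v z') c' ih') (Nat.blt (Nat.add v z') (Nat.add u z))) t) s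

theorem sum_keep {lo hi : ℕ} {f : ℕ → ℕ} (hf : ∀ z, f z ≠ 0 → lo ≤ z ∧ z < hi) (z c : ℕ)
    (t : Tally) : (keep lo hi z c t).sum f = c * f z + t.sum f := by
  have h0 : ¬ (lo ≤ z ∧ z < hi) → f z = 0 := fun h => by_contra fun h' => h (hf z h')
  rw [keep]
  rcases h1 : Nat.ble lo z with _ | _
  · have : f z = 0 := h0 fun h => by simp [ble_iff.2 h.1] at h1
    simp [this]
  · rcases h2 : Nat.blt z hi with _ | _
    · have : f z = 0 := h0 fun h => by simp [blt_iff.2 h.2] at h2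
      simp [this]
    · rfl

/-- A tally is described by the sums over it of test functions supported in the window; values
dropped outside the window do not affect these. -/
theorem sum_merge {u v lo hi : ℕ} {f : ℕ → ℕ} (hf : ∀ z, f z ≠ 0 → lo ≤ z ∧ z < hi)
    (s : Tally) : ∀ t : Tally, (merge u v lo hi s t).sum f =
      s.sum (fun z => f (u + z)) + t.sum (fun z => f (v + z)) := by
  induction s with
  | nil =>
    intro t
    induction t with
    | nil => rfl
    | cons z c t ih =>
      change (keep lo hi (v + z) c (merge u v lo hi nil t)).sum f = _
      rw [sum_keep hf, ih]
      simp only [sum]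
      ring
  | cons z c s ih =>
    intro t
    induction t with
    | nil =>
      change (keep lo hi (u + z) c (merge u v lo hi s nil)).sum f = _
      rw [sum_keep hf, ih]
      simp only [sum]
      ring
    | cons z' c' t ih' =>
      have e : merge u v lo hi (cons z c s) (cons z' c' t) =
        Bool.rec
            (Bool.rec (keep lo hi (u + z) (c + c') (merge u v lo hi s t))
              (keep lo hi (u + z) c (merge u v lo hi s (cons z' c' t)))
              (Nat.blt (u + z) (v + z')))
            (keep lo hi (v + z') c' (merge u v lo hi (cons z c s) t))
            (Nat.blt (v + z') (u + z)) := rfl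
      rw [e]
      rcases h1 : Nat.blt (v + z') (u + z) with _ | _
      · rcases h2 : Nat.blt (u + z) (v + z') with _ | _
        · have hz : u + z = v + z' := by
            have h3 : ¬ v + z' < u + z := fun h => by simp [blt_iff.2 h] at h1
            have h4 : ¬ u + z < v + z' := fun h => by simp [blt_iff.2 h] at h2
            omega
          simp only [sum_keep hf, ih, sum, hz]
          ring
        · simp only [sum_keep hf, ih, sum]
          ring
      · simp only [sum_keep hf, ih', sum]
        ring

end Tally

/-- The sum of `f` over all sums of choices from a list of pairs. -/
def choiceSum : List (ℕ × ℕ) → (ℕ → ℕ) → ℕ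
  | [], f => f 0
  | x :: l, f => choiceSum l (fun z => f (x.1 + z)) + choiceSum l (fun z => f (x.2 + z))

/-- The largest sum of choices from a list of pairs. -/
def maxSum : List (ℕ × ℕ) → ℕ
  | [] => 0
  | x :: l => max x.1 x.2 + maxSum l

theorem choiceSum_ne_zero {l : List (ℕ × ℕ)} : ∀ {f : ℕ → ℕ}, choiceSum l f ≠ 0 →
    ∃ y ≤ maxSum l, f y ≠ 0 := by
  induction l with
  | nil => intro f h; exact ⟨0, le_rfl, h⟩
  | cons x l ih =>
    intro f h
    rw [choiceSum] at h
    have : choiceSum l (fun z => f (x.1 + z)) ≠ 0 ∨ choiceSum l (fun z => f (x.2 + z)) ≠ 0 := by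
      omega
    rcases this with h | h
    · obtain ⟨y, hy, hf⟩ := ih h
      exact ⟨x.1 + y, add_le_add (le_max_left _ _) hy, hf⟩
    · obtain ⟨y, hy, hf⟩ := ih h
      exact ⟨x.2 + y, add_le_add (le_max_right _ _) hy, hf⟩

/-- Each index contributes `u i` or `v i` according to membership, so subsets correspond to
sequences of choices. -/
theorem sum_powerset_eq_choiceSum {ι : Type*} [DecidableEq ι] (u v : ι → ℕ) (l : List ι)
    (hl : l.Nodup) : ∀ f : ℕ → ℕ,
    ∑ S ∈ l.toFinset.powerset, f (∑ i ∈ S, u i + ∑ i ∈ l.toFinset \ S, v i) =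
      choiceSum (l.map fun i => (u i, v i)) f := by
  induction l with
  | nil => intro f; simp [choiceSum]
  | cons a l ih =>
    intro f
    rw [List.nodup_cons] at hl
    have ha : a ∉ l.toFinset := by simpa using hl.1
    rw [List.toFinset_cons, Finset.sum_powerset_insert ha, List.map_cons, choiceSum, ← ih hl.2,
      ← ih hl.2, add_comm]
    congr 1
    · refine Finset.sum_congr rfl fun S hS => ?_
      have hSa : a ∉ S := fun h => ha (mem_powerset.1 hS h)
      rw [Finset.sum_insert hSa, Finset.insert_sdiff_insert, Finset.sdiff_insert_of_notMem ha,
        add_assoc]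
    · refine Finset.sum_congr rfl fun S hS => ?_
      have hSa : a ∉ S := fun h => ha (mem_powerset.1 hS h)
      rw [Finset.insert_sdiff_of_notMem _ hSa, Finset.sum_insert (by simp [ha])]
      congr 1
      ring

/-- Tally the sums of choices that lie in the interval of length `d` that starts at `w`. -/
noncomputable def runTally (w d : ℕ) : List (ℕ × ℕ) → Tally → Tally
  | [], s => s
  | x :: l, s => runTally w d l (s.merge x.1 x.2 (w - maxSum l) (w + d) s)

theorem Tally.sum_add (f g : ℕ → ℕ) (s : Tally) :
    s.sum (fun z => f z + g z) = s.sum f + s.sum g := by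
  induction s with
  | nil => rfl
  | cons z c s ih =>
    simp only [Tally.sum, ih]
    ring

/-- Pruning is harmless: the remaining choices add between 0 and `maxSum l`, so a partial sum
outside the kept interval cannot end in the window. -/
theorem sum_runTally {w d : ℕ} {f : ℕ → ℕ} (hf : ∀ z, f z ≠ 0 → w ≤ z ∧ z < w + d)
    (l : List (ℕ × ℕ)) : ∀ s : Tally, (runTally w d l s).sum f =
      s.sum fun z => choiceSum l fun y => f (z + y) := by
  induction l with
  | nil => intro s; rfl
  | cons x l ih =>
    intro s
    rw [runTally, ih, Tally.sum_merge, ← Tally.sum_add]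
    · congr 1
      funext z
      simp only [choiceSum, add_assoc, add_left_comm z]
    · intro z hz
      obtain ⟨y, hy, h⟩ := choiceSum_ne_zero hz
      have := hf _ h
      omega

namespace Tally

/-- The values in `s` that exceed `w` by at most `h / 2`. -/
def values (w h : ℕ) : Tally → Finset ℕ
  | nil => ∅
  | cons z _ t => if w < z ∧ 2 * (z - w) ≤ h then insert z (values w h t) else values w h t

/-- One step of `check`. -/
noncomputable def checkStep (w h q C L z c p cnt len : ℕ) (yes no : Bool) : Bool :=
  Bool.rec false (Bool.rec false (Bool.rec false (Bool.rec false
    (Bool.rec no (Bool.rec no (Bool.rec false yes (Nat.beq (Nat.mod (Nat.sub z w) q) 0))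
      (Nat.ble (Nat.mul 2 (Nat.sub z w)) h)) (Nat.blt w z))
    (Nat.blt 0 c)) (Nat.ble p z)) (Nat.ble cnt C)) (Nat.ble len L)

/-- Check that the values in a tally increase, that those that exceed `w` by at most `h / 2` exceed
it by multiples of `q`, and that there are `L` of them, with total multiplicity `C`. -/
noncomputable def check (w h q C L : ℕ) (s : Tally) : ℕ → ℕ → ℕ → Bool :=
  Tally.rec (motive := fun _ => ℕ → ℕ → ℕ → Bool)
    (fun _ cnt len => Nat.beq cnt C && Nat.beq len L)
    (fun z c _ ih p cnt len => checkStep w h q C L z c p cnt len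
      (ih (Nat.succ z) (Nat.add cnt c) (Nat.succ len)) (ih (Nat.succ z) cnt len)) s

theorem checkStep_eq_true {w h q C L z c p cnt len : ℕ} {yes no : Bool}
    (H : checkStep w h q C L z c p cnt len yes no = true) : p ≤ z ∧ 0 < c ∧
      (((w < z ∧ 2 * (z - w) ≤ h) ∧ q ∣ z - w ∧ yes = true) ∨
        (¬ (w < z ∧ 2 * (z - w) ≤ h) ∧ no = true)) := by
  unfold checkStep at H
  rcases h1 : Nat.ble len L with _ | _ <;> simp only [h1, Bool.false_eq_true] at H
  rcases h2 : Nat.ble cnt C with _ | _ <;> simp only [h2, Bool.false_eq_true] at H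
  rcases h3 : Nat.ble p z with _ | _ <;> simp only [h3, Bool.false_eq_true] at H
  rcases h4 : Nat.blt 0 c with _ | _ <;> simp only [h4, Bool.false_eq_true] at H
  refine ⟨ble_iff.1 h3, blt_iff.1 h4, ?_⟩
  rcases h5 : Nat.blt w z with _ | _ <;> simp only [h5] at H
  · exact Or.inr ⟨fun h => by simp [blt_iff.2 h.1] at h5, H⟩
  rcases h6 : Nat.ble (Nat.mul 2 (Nat.sub z w)) h with _ | _ <;> simp only [h6] at H
  · refine Or.inr ⟨fun h' => ?_, H⟩
    have := ble_iff.2 h'.2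
    rw [show Nat.ble (2 * (z - w)) h = false from h6] at this
    exact absurd this (by simp)
  rcases h7 : Nat.beq (Nat.mod (Nat.sub z w) q) 0 with _ | _ <;>
    simp only [h7, Bool.false_eq_true] at H
  exact Or.inl ⟨⟨blt_iff.1 h5, ble_iff.1 h6⟩,
    Nat.dvd_of_mod_eq_zero (Nat.eq_of_beq_eq_true h7), H⟩

/-- The values strictly increase, so counting list entries counts distinct values; positive
multiplicities ensure that each value is attained. -/
theorem check_spec {w h q C L : ℕ} (s : Tally) : ∀ {p cnt len : ℕ},
    check w h q C L s p cnt len = true →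
    cnt + s.sum (fun z => if w < z ∧ 2 * (z - w) ≤ h then 1 else 0) = C ∧
    len + (s.values w h).card = L ∧
    (∀ z ∈ s.values w h, p ≤ z ∧ q ∣ z - w) ∧
    ∀ z, z ∈ s.values w h ↔
      (w < z ∧ 2 * (z - w) ≤ h) ∧ s.sum (fun y => if y = z then 1 else 0) ≠ 0 := by
  induction s with
  | nil =>
    intro p cnt len H
    have H' : (Nat.beq cnt C && Nat.beq len L) = true := H
    rw [Bool.and_eq_true] at H'
    exact ⟨Nat.eq_of_beq_eq_true H'.1, Nat.eq_of_beq_eq_true H'.2, by simp [values],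
      by simp [values, sum]⟩
  | cons z c s ih =>
    intro p cnt len H
    have H' : checkStep w h q C L z c p cnt len
      (check w h q C L s (z + 1) (cnt + c) (len + 1)) (check w h q C L s (z + 1) cnt len) = true := H
    obtain ⟨hp, hc, ⟨hz, hq, H1⟩ | ⟨hz, H1⟩⟩ := checkStep_eq_true H'
    · obtain ⟨i1, i2, i3, i4⟩ := ih H1
      have hn : z ∉ s.values w h := fun hm => by have := (i3 z hm).1; omega
      simp only [values, if_pos hz, sum, Finset.card_insert_of_notMem hn]
      refine ⟨by omega, by omega, ?_, ?_⟩
      · intro y hy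
        rcases Finset.mem_insert.1 hy with rfl | hy
        · exact ⟨hp, hq⟩
        · exact ⟨by have := (i3 y hy).1; omega, (i3 y hy).2⟩
      · intro y
        rw [Finset.mem_insert, i4]
        by_cases hyz : y = z
        · subst hyz
          simp [hz, hc.ne']
        · simp [hyz, Ne.symm hyz]
    · obtain ⟨i1, i2, i3, i4⟩ := ih H1
      simp only [values, if_neg hz, sum, mul_zero, zero_add]
      refine ⟨i1, i2, fun y hy => ⟨by have := (i3 y hy).1; omega, (i3 y hy).2⟩, fun y => ?_⟩
      rw [i4]
      by_cases hyz : y = z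
      · subst hyz
        simp only [hz, false_and]
      · simp [Ne.symm hyz]

end Tally
-- Encoding and counting the solutions
/-- The sets of graphs whose copies form a design with at most half the maximal index. -/
def solutions (n : ℕ) : Finset (Finset (Fin 26)) :=
  {S ∈ (fitting n).powerset | (n + 1) * adjacentMass n S = 40 * mass n S ∧ 0 < mass n S ∧
    2 * mass n S ≤ unitMass n * (n.choose 2 - 2).choose 3}

/-- The contributions of a graph to the encoded sum if it is chosen and if it is not chosen. The
excess of adjacent over disjoint pairs is encoded in the digits above the sixtieth. -/
def contribution (n : ℕ) (i : Fin 26) : ℕ × ℕ :=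
  (((n + 1) * adjacencies i - 40) * copies n i * 2 ^ 60 + copies n i,
    (40 - (n + 1) * adjacencies i) * copies n i * 2 ^ 60)

/-- The graphs that fit, with large contributions first. -/
def choices (n : ℕ) : List (Fin 26) :=
  ((List.finRange 26).filter fun i => (graph i).order ≤ n).insertionSort fun i j =>
    (contribution n j).1 + (contribution n j).2 ≤ (contribution n i).1 + (contribution n i).2

/-- Check the solutions that are encoded by a list of contributions. -/
noncomputable def checkSolutions (h q C L : ℕ) (l : List (ℕ × ℕ)) (w : ℕ) : Bool :=
  (runTally w (2 ^ 60) l (.cons 0 1 .nil)).check w h q C L 0 0 0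

/-- Check that there are `C` solutions with `L` different masses. -/
noncomputable def countCheck (n C L : ℕ) : Bool :=
  Nat.ble (mass n univ + 1) (2 ^ 60) && Nat.ble (unitMass n * (n.choose 2 - 2).choose 3 + 1) (2 ^ 60)
    && checkSolutions (unitMass n * (n.choose 2 - 2).choose 3) (unitMass n) C L
      ((choices n).map (contribution n)) (((choices n).map fun i => (contribution n i).2).sum)

theorem choices_nodup (n : ℕ) : (choices n).Nodup :=
  (List.perm_insertionSort _ _).nodup_iff.2 ((List.nodup_finRange 26).filter _)

theorem choices_toFinset (n : ℕ) : (choices n).toFinset = fitting n := by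
  ext i
  simp [choices, (List.perm_insertionSort _ _).mem_iff, mem_fitting]

/-- The encoded sum of a set of graphs. -/
def encode (n : ℕ) (S : Finset (Fin 26)) : ℕ :=
  ∑ i ∈ S, (contribution n i).1 + ∑ i ∈ fitting n \ S, (contribution n i).2

theorem encode_eq (n : ℕ) (S : Finset (Fin 26)) :
    encode n S = 2 ^ 60 * (∑ i ∈ S, ((n + 1) * adjacencies i - 40) * copies n i +
      ∑ i ∈ fitting n \ S, (40 - (n + 1) * adjacencies i) * copies n i) + mass n S := by
  simp only [encode, contribution, mass, Finset.sum_add_distrib, ← Finset.sum_mul]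
  ring

theorem sum_contribution {n : ℕ} {S : Finset (Fin 26)} (hS : S ⊆ fitting n) :
    ((choices n).map fun i => (contribution n i).2).sum =
      2 ^ 60 * (∑ i ∈ S, (40 - (n + 1) * adjacencies i) * copies n i +
        ∑ i ∈ fitting n \ S, (40 - (n + 1) * adjacencies i) * copies n i) := by
  rw [← List.sum_toFinset _ (choices_nodup n), choices_toFinset, ← Finset.sum_sdiff hS]
  simp only [contribution, ← Finset.sum_mul]
  ring

/-- Truncated subtraction splits the signed excess (n+1)a − 40 into positive and negative parts;
balance says that their weighted sums agree. -/
theorem excess_eq_iff (n : ℕ) (S : Finset (Fin 26)) :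
    ∑ i ∈ S, ((n + 1) * adjacencies i - 40) * copies n i =
      ∑ i ∈ S, (40 - (n + 1) * adjacencies i) * copies n i ↔
      (n + 1) * adjacentMass n S = 40 * mass n S := by
  have h : ∑ i ∈ S, ((n + 1) * adjacencies i - 40) * copies n i + 40 * mass n S =
      (n + 1) * adjacentMass n S + ∑ i ∈ S, (40 - (n + 1) * adjacencies i) * copies n i := by
    rw [mass, adjacentMass, Finset.mul_sum, Finset.mul_sum, ← Finset.sum_add_distrib,
      ← Finset.sum_add_distrib]
    refine Finset.sum_congr rfl fun i _ => ?_
    rw [← add_mul, mul_comm (copies n i) (adjacencies i), ← mul_assoc, ← add_mul]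
    congr 1
    omega
  omega

/-- Relative to `w`, the encoded sum is 2^60 times the signed excess plus the mass. As the mass and
the bound are below 2^60, lying in the narrow interval above `w` forces excess zero and leaves the
mass as the difference. -/
theorem mem_solutions_iff {n : ℕ} (h1 : mass n univ < 2 ^ 60)
    (h2 : unitMass n * (n.choose 2 - 2).choose 3 < 2 ^ 60) {S : Finset (Fin 26)}
    (hS : S ⊆ fitting n) {w : ℕ} (hw : w = ((choices n).map fun i => (contribution n i).2).sum) :
    (S ∈ solutions n → encode n S = w + mass n S) ∧
    (S ∈ solutions n ↔ w < encode n S ∧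
      2 * (encode n S - w) ≤ unitMass n * (n.choose 2 - 2).choose 3) := by
  have hm : mass n S < 2 ^ 60 :=
    (Finset.sum_le_sum_of_subset (Finset.subset_univ S)).trans_lt h1
  have he := excess_eq_iff n S
  simp only [solutions, mem_filter, mem_powerset, hS, true_and, ← he]
  rw [hw, encode_eq, sum_contribution hS]
  generalize ∑ i ∈ S, ((n + 1) * adjacencies i - 40) * copies n i = x
  generalize ∑ i ∈ S, (40 - (n + 1) * adjacencies i) * copies n i = y
  generalize ∑ i ∈ fitting n \ S, (40 - (n + 1) * adjacencies i) * copies n i = z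
  generalize mass n S = m at *
  generalize unitMass n * (n.choose 2 - 2).choose 3 = h at *
  norm_num at *
  omega

/-- The divisibility is part of the check because the balance equation alone does not make the index
mass / `unitMass` an integer. -/
theorem countCheck_spec {n C L : ℕ} (h : countCheck n C L = true) :
    (solutions n).card = C ∧ ((solutions n).image (mass n)).card = L ∧
      ∀ S ∈ solutions n, unitMass n ∣ mass n S := by
  simp only [countCheck, Bool.and_eq_true, ble_iff, Nat.add_one_le_iff] at h
  obtain ⟨⟨h1, h2⟩, h3⟩ := h
  obtain ⟨w, hw⟩ : ∃ w, w = ((choices n).map fun i => (contribution n i).2).sum := ⟨_, rfl⟩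
  have hmem := fun S hS => mem_solutions_iff h1 h2 (S := S) hS hw
  have hsub : ∀ S ∈ solutions n, S ⊆ fitting n := fun S hS =>
    mem_powerset.1 (Finset.mem_filter.1 hS).1
  rw [← hw, checkSolutions] at h3
  obtain ⟨s1, s2, s3, s4⟩ := Tally.check_spec _ h3
  set s := runTally w (2 ^ 60) ((choices n).map (contribution n)) (.cons 0 1 .nil)
  have hs : ∀ f : ℕ → ℕ, (∀ z, f z ≠ 0 → w ≤ z ∧ z < w + 2 ^ 60) →
      s.sum f = ∑ S ∈ (fitting n).powerset, f (encode n S) := by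
    intro f hf
    rw [sum_runTally hf]
    simp only [Tally.sum, one_mul, zero_add, add_zero]
    have := sum_powerset_eq_choiceSum (fun i => (contribution n i).1)
      (fun i => (contribution n i).2) (choices n) (choices_nodup n) f
    rw [choices_toFinset] at this
    exact this.symm
  have hval : s.values w (unitMass n * (n.choose 2 - 2).choose 3) =
      (solutions n).image (encode n) := by
    ext z
    rw [s4, Finset.mem_image]
    constructor
    · rintro ⟨hz, hne⟩
      rw [hs _ fun y hy => by
        obtain rfl : y = z := by_contra fun h => hy (if_neg h)
        omega] at hne
      obtain ⟨S, hS, hSz⟩ := Finset.exists_ne_zero_of_sum_ne_zero hne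
      have hSz' : encode n S = z := by_contra fun h => hSz (if_neg h)
      exact ⟨S, (hmem S (mem_powerset.1 hS)).2.2 (hSz' ▸ hz), hSz'⟩
    · rintro ⟨S, hS, rfl⟩
      have hz := (hmem S (hsub S hS)).2.1 hS
      refine ⟨hz, ?_⟩
      rw [hs _ fun y hy => by
        obtain rfl : y = encode n S := by_contra fun h => hy (if_neg h)
        omega]
      intro h0
      have := Finset.sum_eq_zero_iff.1 h0 S (mem_powerset.2 (hsub S hS))
      simp at this
  -- On solutions the encoding is a translate of the mass, so distinct encoded values count distinct
  -- masses.
  have himage : (solutions n).image (encode n) = ((solutions n).image (mass n)).image (w + ·) := by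
    rw [Finset.image_image]
    exact Finset.image_congr fun S hS => (hmem S (hsub S hS)).1 hS
  refine ⟨?_, ?_, ?_⟩
  · rw [zero_add, hs _ fun y hy => by
      have : w < y ∧ 2 * (y - w) ≤ unitMass n * (n.choose 2 - 2).choose 3 :=
        by_contra fun h => hy (if_neg h)
      omega] at s1
    rw [← s1, ← Finset.sum_filter, ← Finset.card_eq_sum_ones]
    congr 1
    ext S
    rw [Finset.mem_filter, mem_powerset]
    exact ⟨fun h => ⟨hsub S h, (hmem S (hsub S h)).2.1 h⟩, fun h => (hmem S h.1).2.2 h.2⟩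
  · rw [← s2, hval, himage, zero_add, Finset.card_image_of_injective _ (add_right_injective w)]
  · intro S hS
    have h := (s3 (encode n S) (hval ▸ Finset.mem_image_of_mem _ hS)).2
    rwa [(hmem S (hsub S hS)).1 hS, Nat.add_sub_cancel_left] at h

/-- The numbers of solutions, and of their masses, for `5 ≤ n ≤ 39`. -/
def solutionCounts : List (ℕ × ℕ) :=
    [(5, 2), (310, 49), (14191, 180), (21260, 38), (107519, 271), (17590, 288), (53197, 1051),
    (10024, 361), (12448, 431), (6128, 601), (13942, 2501), (698, 140), (2736, 250), (2625, 307),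
    (931, 158), (387, 99), (2362, 600), (535, 147), (1686, 418), (766, 170), (206, 52), (221, 68),
    (577, 177), (74, 20), (376, 94), (276, 52), (134, 31), (23, 7), (37, 20), (24, 13), (32, 9),
    (28, 6), (8, 5), (3, 2), (1, 1)]

/-- The number of solutions and the number of their masses for a given `n`. -/
def solutionCount (n : ℕ) : ℕ × ℕ := solutionCounts.getD (n - 5) (0, 0)

/-- Check the expected counts for a given `n`. -/
noncomputable def checkAt (n : ℕ) : Bool := countCheck n (solutionCount n).1 (solutionCount n).2

theorem checkAt_5_to_10 : ∀ i : Fin 6, checkAt (i + 5) = true := by decide +kernel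

theorem checkAt_11_to_12 : ∀ i : Fin 2, checkAt (i + 11) = true := by decide +kernel

theorem checkAt_13_to_14 : ∀ i : Fin 2, checkAt (i + 13) = true := by decide +kernel

theorem checkAt_15_to_16 : ∀ i : Fin 2, checkAt (i + 15) = true := by decide +kernel

theorem checkAt_17_to_19 : ∀ i : Fin 3, checkAt (i + 17) = true := by decide +kernel

theorem checkAt_20_to_22 : ∀ i : Fin 3, checkAt (i + 20) = true := by decide +kernel

theorem checkAt_23_to_39 : ∀ i : Fin 17, checkAt (i + 23) = true := by decide +kernel

theorem checkAt_eq_true {n : ℕ} (h5 : 5 ≤ n) (h39 : n ≤ 39) : checkAt n = true := by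
  by_cases h10 : n ≤ 10
  · simpa [Nat.sub_add_cancel (by omega : 5 ≤ n)] using checkAt_5_to_10 ⟨n - 5, by omega⟩
  by_cases h12 : n ≤ 12
  · simpa [Nat.sub_add_cancel (by omega : 11 ≤ n)] using checkAt_11_to_12 ⟨n - 11, by omega⟩
  by_cases h14 : n ≤ 14
  · simpa [Nat.sub_add_cancel (by omega : 13 ≤ n)] using checkAt_13_to_14 ⟨n - 13, by omega⟩
  by_cases h16 : n ≤ 16
  · simpa [Nat.sub_add_cancel (by omega : 15 ≤ n)] using checkAt_15_to_16 ⟨n - 15, by omega⟩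
  by_cases h19 : n ≤ 19
  · simpa [Nat.sub_add_cancel (by omega : 17 ≤ n)] using checkAt_17_to_19 ⟨n - 17, by omega⟩
  by_cases h22 : n ≤ 22
  · simpa [Nat.sub_add_cancel (by omega : 20 ≤ n)] using checkAt_20_to_22 ⟨n - 20, by omega⟩
  simpa [Nat.sub_add_cancel (by omega : 23 ≤ n)] using checkAt_23_to_39 ⟨n - 23, by omega⟩

/-! ### Designs as solutions and the range of n -/

theorem card_powersetCard_superset {α : Type*} [DecidableEq α] {s T : Finset α} (hT : T ⊆ s)
    (k : ℕ) : {b ∈ powersetCard (T.card + k) s | T ⊆ b}.card = (s.card - T.card).choose k := by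
  rw [← Finset.card_sdiff_of_subset hT, ← Finset.card_powersetCard]
  refine Finset.card_bij' (fun b _ => b \ T) (fun c _ => c ∪ T) ?_ ?_ ?_ ?_
  · intro b hb
    simp only [mem_filter, mem_powersetCard] at hb
    rw [mem_powersetCard, Finset.card_sdiff_of_subset hb.2, hb.1.2]
    exact ⟨Finset.sdiff_subset_sdiff hb.1.1 le_rfl, by omega⟩
  · intro c hc
    rw [mem_powersetCard] at hc
    have hd : Disjoint c T := Finset.disjoint_of_subset_left hc.1 Finset.sdiff_disjoint
    simp only [mem_filter, mem_powersetCard]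
    rw [Finset.card_union_of_disjoint hd, hc.2]
    exact ⟨⟨Finset.union_subset (hc.1.trans Finset.sdiff_subset) hT, by omega⟩,
      Finset.subset_union_right⟩
  · intro b hb
    exact Finset.sdiff_union_of_subset (mem_filter.1 hb).2
  · intro c hc
    rw [mem_powersetCard] at hc
    have hd : Disjoint c T := Finset.disjoint_of_subset_left hc.1 Finset.sdiff_disjoint
    exact Finset.union_sdiff_cancel_right hd

theorem card_edge (n : ℕ) : Fintype.card (Edge n) = n.choose 2 := by
  rw [← Nat.card_eq_fintype_card, Set.powersetCard.card, Nat.card_eq_fintype_card, Fintype.card_fin]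

theorem degree_all {n : ℕ} {T : Finset (Edge n)} (hT : T.card = 2) :
    {b ∈ {b : Finset (Edge n) | b.card = 5} | T ⊆ b}.ncard = (n.choose 2 - 2).choose 3 := by
  have h := card_powersetCard_superset (Finset.subset_univ T) 3
  rw [hT, Finset.card_univ, card_edge] at h
  rw [← h, ← Set.ncard_coe_finset]
  congr 1
  ext b
  simp [mem_powersetCard]

theorem isClosed_all (n : ℕ) : IsClosed {b : Finset (Edge n) | b.card = 5} := fun g c => by
  simp [card_moveEdges]

theorem graphsOf_all (n : ℕ) : graphsOf {b : Finset (Edge n) | b.card = 5} = fitting n := by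
  ext i
  rw [mem_graphsOf]
  exact ⟨fun h => h.1, fun h => ⟨h, card_copy h⟩⟩

/-- The family of all 5-subsets is balanced; this lets balance pass to complements. -/
theorem balance_fitting {n : ℕ} (hn : 4 ≤ n) :
    (n + 1) * adjacentMass n (fitting n) = 40 * mass n (fitting n) := by
  have := ((balanced_iff hn (isClosed_all n) (fun _ h => h) _).1 fun T hT => degree_all hT).1
  rwa [graphsOf_all] at this

theorem mass_pos {n : ℕ} {S : Finset (Fin 26)} (hS : S ⊆ fitting n) (h : S.Nonempty) :
    0 < mass n S :=
  Finset.sum_pos (fun _ hi => copies_pos (hS hi)) h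

section Family

variable {n lam : ℕ} {B : Set (Finset (Edge n))}

theorem graphsOf_nonempty (hB : IsClosed B) (hD : IsDesign 2 5 lam B) : (graphsOf B).Nonempty := by
  rw [Finset.nonempty_iff_ne_empty]
  intro h
  obtain ⟨b, hb⟩ := hD.nonempty
  rw [← family_graphsOf hB hD.uniform, h] at hb
  obtain ⟨i, hi, -⟩ := hb
  simp at hi

theorem graphsOf_ne_fitting (hB : IsClosed B) (hD : IsDesign 2 5 lam B) :
    graphsOf B ≠ fitting n := by
  intro h
  apply hD.ne_all
  rw [← family_graphsOf hB hD.uniform, h, ← graphsOf_all,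
    family_graphsOf (isClosed_all n) fun _ h => h]

/-- On four vertices only K_4 minus an edge fits, so a nonempty family would already be the complete
one. -/
theorem five_le (hB : IsClosed B) (hD : IsDesign 2 5 lam B) : 5 ≤ n := by
  by_contra! hn
  have h4 : fitting n ⊆ fitting 4 := fun i hi => by
    rw [mem_fitting] at *
    omega
  have h1 : (fitting 4).card = 1 := by decide
  have hpos := Finset.card_pos.2 (graphsOf_nonempty hB hD)
  have hle := Finset.card_le_card h4
  exact graphsOf_ne_fitting hB hD
    (Finset.eq_of_subset_of_card_le (graphsOf_subset B) (by omega))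

theorem eq_empty_of_balance (hn : 40 ≤ n) {S : Finset (Fin 26)} (hS : S ⊆ fitting n)
    (h25 : 25 ∉ S) (h : (n + 1) * adjacentMass n S = 40 * mass n S) : S = ∅ := by
  by_contra hne
  have hpos := mass_pos hS (Finset.nonempty_iff_ne_empty.2 hne)
  have h1 : ∀ i, i ≠ 25 → 1 ≤ adjacencies i := by decide
  have hle : mass n S ≤ adjacentMass n S := Finset.sum_le_sum fun i hi =>
    Nat.le_mul_of_pos_right _ (h1 i fun h => h25 (h ▸ hi))
  -- Every graph other than the matching has an adjacent pair, so 41 · mass ≤ 40 · mass.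
  have := Nat.mul_le_mul (by omega : 41 ≤ n + 1) hle
  omega

theorem lt_forty (hB : IsClosed B) (hD : IsDesign 2 5 lam B) : n < 40 := by
  by_contra! hn
  have hb := ((balanced_iff (by omega) hB hD.uniform lam).1 hD.balanced).1
  by_cases h25 : (25 : Fin 26) ∈ graphsOf B
  · have hc : fitting n \ graphsOf B = ∅ := by
      refine eq_empty_of_balance hn Finset.sdiff_subset (by simp [h25]) ?_
      have hf := balance_fitting (by omega : 4 ≤ n)
      rw [mass, ← Finset.sum_sdiff (graphsOf_subset B), adjacentMass,
        ← Finset.sum_sdiff (graphsOf_subset B)] at hf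
      rw [mass, adjacentMass] at hb ⊢
      linarith
    exact graphsOf_ne_fitting hB hD 
      ((graphsOf_subset B).antisymm (Finset.sdiff_eq_empty_iff_subset.1 hc))
  · exact (graphsOf_nonempty hB hD).ne_empty
      (eq_empty_of_balance hn (graphsOf_subset B) h25 hb)

theorem unitMass_pos (hn : 5 ≤ n) : 0 < unitMass n := by
  have : 0 < n.descFactorial 3 := Nat.descFactorial_pos.2 (by omega)
  rw [unitMass]
  positivity

theorem le_half_iff (a b : ℕ) : (a : ℚ) ≤ 1 / 2 * (b : ℚ) ↔ 2 * a ≤ b := by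
  rw [← Nat.cast_le (α := ℚ)]
  push_cast
  constructor <;> intro h <;> linarith

theorem graphsOf_mem_solutions (hB : IsClosed B) (hD : IsDesign 2 5 lam B)
    (hlam : (lam : ℚ) ≤ 1 / 2 * ((n.choose 2 - 2).choose 3 : ℚ)) :
    graphsOf B ∈ solutions n ∧ mass n (graphsOf B) = unitMass n * lam := by
  have hn := five_le hB hD
  have hb := (balanced_iff (by omega) hB hD.uniform lam).1 hD.balanced
  refine ⟨?_, hb.2⟩
  rw [solutions, mem_filter, mem_powerset]
  refine ⟨graphsOf_subset B, hb.1, mass_pos (graphsOf_subset B) (graphsOf_nonempty hB hD), ?_⟩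
  rw [hb.2, mul_left_comm]
  exact Nat.mul_le_mul_left _ ((le_half_iff _ _).1 hlam)

end Family

theorem isDesign_family {n : ℕ} (hn : 5 ≤ n) {S : Finset (Fin 26)} (hS : S ∈ solutions n)
    (hdvd : unitMass n ∣ mass n S) : IsDesign 2 5 (mass n S / unitMass n) (family n S) := by
  obtain ⟨hsub, hbal, hpos, hle⟩ := by simpa [solutions] using hS
  have hu : ∀ b ∈ family n S, b.card = 5 := fun b hb => card_of_mem_family hsub hb
  have hmass : mass n S = unitMass n * (mass n S / unitMass n) := (Nat.mul_div_cancel' hdvd).symm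
  have hb : ∀ T : Finset (Edge n), T.card = 2 →
      {b ∈ family n S | T ⊆ b}.ncard = mass n S / unitMass n := by
    rw [balanced_iff (by omega) (isClosed_family n S) hu, graphsOf_family hsub]
    exact ⟨hbal, hmass⟩
  refine ⟨le_rfl, by norm_num, hu, hb, ?_, ?_⟩
  · obtain ⟨i, hi⟩ : S.Nonempty := by
      rw [Finset.nonempty_iff_ne_empty]
      rintro rfl
      simp [mass] at hpos
    exact ⟨copy n i, i, hi, 1, moveEdges_one _⟩
  · intro hall
    have h1 : graphsOf (family n S) = fitting n := by rw [hall, graphsOf_all]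
    have h2 := ((balanced_iff (by omega) (isClosed_all n) (fun _ h => h) _).1
      fun T hT => degree_all hT).2
    -- The complete family has the maximal index, whereas a solution has positive mass and at most
    -- half of that index.
    rw [graphsOf_all, ← h1, graphsOf_family hsub] at h2
    omega

theorem solutionCount_spec {n : ℕ} (h5 : 5 ≤ n) (h39 : n < 40) :
    (solutions n).card = (solutionCount n).1 ∧
    ((solutions n).image (mass n)).card = (solutionCount n).2 ∧
      ∀ S ∈ solutions n, unitMass n ∣ mass n S :=
  countCheck_spec (checkAt_eq_true h5 (by omega))

/-! ### Equivalence classes of graphical designs -/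

theorem IsDesign.mapBlocks {t k lam : ℕ} {X Y : Type*} {B : Set (Finset X)}
    (h : IsDesign t k lam B) (e : X ≃ Y) : IsDesign t k lam (mapBlocks e B) where
  two_le := h.two_le
  lt := h.lt
  uniform := by
    rintro _ ⟨b, hb, rfl⟩
    rw [Finset.card_map, h.uniform b hb]
  balanced := by
    intro T hT
    rw [← h.balanced (T.map e.symm.toEmbedding) (by rw [Finset.card_map, hT]),
      ← Set.ncard_image_of_injective _ (Finset.map_injective e.toEmbedding)]
    congr 1
    have hsub : ∀ b : Finset X, T ⊆ b.map e.toEmbedding ↔ T.map e.symm.toEmbedding ⊆ b := by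
      intro b
      simp only [Finset.subset_iff, Finset.mem_map_equiv, Equiv.symm_symm]
      exact ⟨fun h x hx => by simpa using h hx, fun h x hx => h (by simpa using hx)⟩
    ext b
    constructor
    · rintro ⟨⟨b, hb, rfl⟩, hT⟩
      exact ⟨b, ⟨hb, (hsub b).1 hT⟩, rfl⟩
    · rintro ⟨b, ⟨hb, hT⟩, rfl⟩
      exact ⟨⟨b, hb, rfl⟩, (hsub b).2 hT⟩
  nonempty := h.nonempty.image _
  ne_all := by
    intro hall
    apply h.ne_all
    rw [← mapBlocks_symm e hall]
    ext b
    constructor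
    · rintro ⟨c, hc, rfl⟩
      rw [Set.mem_ofPred_eq, Finset.card_map]
      exact hc
    · intro hb
      refine ⟨b.map e.toEmbedding, ?_, ?_⟩
      · rw [Set.mem_ofPred_eq, Finset.card_map]
        exact hb
      · ext x
        simp

/-- The graphical design on the edges of a complete graph with the given blocks. -/
def ofFamily (n lam : ℕ) (B : Set (Finset (Edge n))) (hB : IsClosed B) (hD : IsDesign 2 5 lam B) :
    GraphicalDesign 2 5 where
  n := n
  lam := lam
  X := Edge n
  finite := inferInstance
  B := B
  H := pairGroup n
  card_eq := by rw [Nat.card_eq_fintype_card, card_edge]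
  isDesign := hD
  le_aut := pairGroup_le_autGroup.2 hB
  permIso := ⟨Equiv.refl _, MulEquiv.refl _, fun _ _ => rfl⟩

/-- The bijection of the permutation isomorphism conjugates `D.H` onto `pairGroup D.n`, so
transporting the blocks along it gives the standard model. -/
theorem exists_equivalent_ofFamily (D : GraphicalDesign 2 5) :
    ∃ B hB hD, D.Equivalent (ofFamily D.n D.lam B hB hD) := by
  obtain ⟨e, φ, hφ⟩ := D.permIso
  have hperm : ∀ h : D.H, e.permCongrHom (h : Perm D.X) = (φ h : Perm (Edge D.n)) := by
    intro h
    ext1 y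
    have := hφ h (e.symm y)
    rw [Equiv.apply_symm_apply] at this
    exact this
  have hmap : D.H.map (e.permCongrHom : Perm D.X →* Perm (Edge D.n)) = pairGroup D.n := by
    ext σ
    constructor
    · rintro ⟨h, hh, rfl⟩
      exact (hperm ⟨h, hh⟩).symm ▸ (φ ⟨h, hh⟩).2
    · intro hσ
      refine ⟨φ.symm ⟨σ, hσ⟩, (φ.symm ⟨σ, hσ⟩).2, ?_⟩
      exact (hperm _).trans (by rw [MulEquiv.apply_symm_apply])
  have haut : pairGroup D.n ≤ autGroup (mapBlocks e D.B) := by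
    rw [← hmap]
    rintro _ ⟨h, hh, rfl⟩
    have h1 : mapBlocks h D.B = D.B := D.le_aut hh
    change mapBlocks (e.symm.trans (h.trans e)) (mapBlocks e D.B) = mapBlocks e D.B
    rw [mapBlocks_trans, mapBlocks_symm e rfl, mapBlocks_trans, h1]
  exact ⟨mapBlocks e D.B, pairGroup_le_autGroup.1 haut, D.isDesign.mapBlocks e, e, rfl, hmap⟩

theorem choose_two_injective {m n : ℕ} (hm : 5 ≤ m) (hn : 5 ≤ n) (h : m.choose 2 = n.choose 2) :
    m = n := by
  have hlt : ∀ {a b : ℕ}, 5 ≤ a → a < b → a.choose 2 < b.choose 2 := by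
    intro a b ha hab
    have h1 : (a + 1).choose 2 = a + a.choose 2 := by rw [Nat.choose_succ_succ, Nat.choose_one_right]
    have h2 := Nat.choose_le_choose 2 (Nat.succ_le_of_lt hab)
    simp only [Nat.succ_eq_add_one] at h2
    omega
  rcases lt_trichotomy m n with h' | h' | h'
  · exact absurd h (hlt hm h').ne
  · exact h'
  · exact absurd h (hlt hn h').ne'

/-- All solutions. -/
def allSolutions : Finset (Σ _ : ℕ, Finset (Fin 26)) := (Icc 5 39).sigma solutions

theorem mem_allSolutions {n : ℕ} {S : Finset (Fin 26)} :
    (⟨n, S⟩ : Σ _ : ℕ, Finset (Fin 26)) ∈ allSolutions ↔ (5 ≤ n ∧ n < 40) ∧ S ∈ solutions n := by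
  simp [allSolutions, Nat.lt_succ_iff]

/-- The graphical design that belongs to a solution. -/
def solutionDesign (p : allSolutions) : GraphicalDesign 2 5 :=
  have hp := mem_allSolutions.1 p.2
  ofFamily p.1.1 (mass p.1.1 p.1.2 / unitMass p.1.1) (family p.1.1 p.1.2)
    (isClosed_family p.1.1 p.1.2) (isDesign_family hp.1.1 hp.2
      ((solutionCount_spec hp.1.1 hp.1.2).2.2 _ hp.2))

/-- The number of points determines n. Then `σ` normalizes `pairGroup m`, hence lies in it and fixes
every invariant family. -/
theorem eq_of_equivalent {p q : allSolutions}
    (h : (solutionDesign p).Equivalent (solutionDesign q)) : p = q := by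
  obtain ⟨⟨m, S⟩, hp⟩ := p
  obtain ⟨⟨n, T⟩, hq⟩ := q
  obtain ⟨hm, hS⟩ := mem_allSolutions.1 hp
  obtain ⟨hn, hT⟩ := mem_allSolutions.1 hq
  obtain ⟨σ, hB, hH⟩ := h
  change Edge m ≃ Edge n at σ
  have hmn : m = n := choose_two_injective hm.1 hn.1 (by
    rw [← card_edge, ← card_edge, Fintype.card_congr σ])
  subst hmn
  change mapBlocks σ (family m S) = family m T at hB
  change (pairGroup m).map (σ.permCongrHom : Perm (Edge m) →* Perm (Edge m)) = pairGroup m at hH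
  have hσ : σ ∈ pairGroup m := by
    refine mem_pairGroup_of_normalizes hm.1 fun g => ?_
    have : σ.permCongrHom (edgePerm g) ∈ pairGroup m :=
      hH ▸ Subgroup.mem_map_of_mem _ (mem_pairGroup.2 ⟨g, rfl⟩)
    obtain ⟨g', hg'⟩ := mem_pairGroup.1 this
    refine ⟨g', fun e => ?_⟩
    rw [hg']
    change _ = σ (edgePerm g (σ.symm (σ e)))
    rw [Equiv.symm_apply_apply]
  have hfix : mapBlocks σ (family m S) = family m S :=
    pairGroup_le_autGroup.2 (isClosed_family m S) hσ
  have hsub : ∀ {S}, S ∈ solutions m → S ⊆ fitting m := fun hS =>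
    mem_powerset.1 (Finset.mem_filter.1 hS).1
  have hST : S = T := by
    rw [← graphsOf_family (hsub hS), ← hfix, hB, graphsOf_family (hsub hT)]
  subst hST
  rfl

theorem order_eq (D : GraphicalDesign 2 5) : D.order = D.n.choose 2 := D.card_eq

theorem solutionDesign_lam_le (p : allSolutions) :
    ((solutionDesign p).lam : ℚ) ≤
      1 / 2 * (((solutionDesign p).order - 2).choose (5 - 2) : ℚ) := by
  obtain ⟨⟨n, S⟩, hp⟩ := p
  obtain ⟨hn, hS⟩ := mem_allSolutions.1 hp
  have hdvd := (solutionCount_spec hn.1 hn.2).2.2 _ hS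
  rw [order_eq]
  change ((mass n S / unitMass n : ℕ) : ℚ) ≤ 1 / 2 * ((n.choose 2 - 2).choose 3 : ℚ)
  rw [le_half_iff]
  have hle := (Finset.mem_filter.1 hS).2.2.2
  rw [← Nat.mul_div_cancel' hdvd, mul_left_comm] at hle
  exact Nat.le_of_mul_le_mul_left hle (unitMass_pos hn.1)

theorem exists_solution {D : GraphicalDesign 2 5}
    (hD : (D.lam : ℚ) ≤ 1 / 2 * ((D.order - 2).choose (5 - 2) : ℚ)) :
    ∃ p : allSolutions, D.Equivalent (solutionDesign p) ∧ p.1.1 = D.n ∧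
      D.lam = (solutionDesign p).lam := by
  obtain ⟨B, hB, hd, σ, h1, h2⟩ := exists_equivalent_ofFamily D
  rw [order_eq] at hD
  obtain ⟨hS, hm⟩ := graphsOf_mem_solutions hB hd hD
  refine ⟨⟨⟨D.n, graphsOf B⟩, mem_allSolutions.2 ⟨⟨five_le hB hd, lt_forty hB hd⟩, hS⟩⟩,
    ⟨σ, h1.trans (family_graphsOf hB hd.uniform).symm, h2⟩, rfl, ?_⟩
  change D.lam = mass D.n (graphsOf B) / unitMass D.n
  rw [hm, Nat.mul_div_cancel_left _ (unitMass_pos (five_le hB hd))]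

theorem classes_eq_range : classes 2 5 =
    Set.range fun p => Quotient.mk (equivalenceSetoid 2 5) (solutionDesign p) := by
  ext c
  constructor
  · rintro ⟨D, hD, rfl⟩
    obtain ⟨p, hp, -⟩ := exists_solution hD
    exact ⟨p, (Quotient.sound hp).symm⟩
  · rintro ⟨p, rfl⟩
    exact ⟨_, solutionDesign_lam_le p, rfl⟩

theorem sum_solutionCount :
    ∑ n ∈ Icc 5 39, (solutionCount n).1 = 271360 ∧ ∑ n ∈ Icc 5 39, (solutionCount n).2 = 8619 := by
  decide +kernel

theorem ncard_classes : (classes 2 5).ncard = 271360 := by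
  rw [classes_eq_range, ← Set.image_univ, Set.ncard_image_of_injective _ fun p q h =>
    eq_of_equivalent (Quotient.exact h), Set.ncard_univ, Nat.card_eq_fintype_card,
    Fintype.card_coe, allSolutions, Finset.card_sigma, ← sum_solutionCount.1]
  refine Finset.sum_congr rfl fun n hn => ?_
  rw [mem_Icc] at hn
  exact (solutionCount_spec hn.1 (by omega)).1

/-! ### The parameter set Ψ -/

/-- The masses of all solutions. -/
def allMasses : Finset (Σ _ : ℕ, ℕ) := (Icc 5 39).sigma fun n => (solutions n).image (mass n)

theorem mem_allMasses {n m : ℕ} : (⟨n, m⟩ : Σ _ : ℕ, ℕ) ∈ allMasses ↔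
    (5 ≤ n ∧ n < 40) ∧ ∃ S ∈ solutions n, mass n S = m := by
  simp [allMasses, Nat.lt_succ_iff]

/-- The parameters that belong to a mass. -/
def parameters (x : Σ _ : ℕ, ℕ) : ℕ × ℕ := (x.1.choose 2, x.2 / unitMass x.1)

theorem psi_eq_image : Psi 2 5 = parameters '' (allMasses : Set (Σ _ : ℕ, ℕ)) := by
  ext ⟨v, lam⟩
  constructor
  · rintro ⟨hle, D, rfl, rfl⟩
    obtain ⟨⟨⟨n, S⟩, hp⟩, -, rfl, hlam⟩ := exists_solution (D := D) hle
    obtain ⟨hn, hS⟩ := mem_allSolutions.1 hp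
    refine ⟨⟨D.n, mass D.n S⟩, mem_allMasses.2 ⟨hn, S, hS, rfl⟩, ?_⟩
    rw [parameters, order_eq, hlam]
    rfl
  · rintro ⟨⟨n, m⟩, hx, hxp⟩
    obtain ⟨hn, S, hS, rfl⟩ := mem_allMasses.1 hx
    have hp := mem_allSolutions.2 ⟨hn, hS⟩
    have hle := solutionDesign_lam_le ⟨_, hp⟩
    have ho : (solutionDesign ⟨_, hp⟩).order = v := by
      rw [order_eq]
      exact congrArg Prod.fst hxp
    have hl : (solutionDesign ⟨_, hp⟩).lam = lam := congrArg Prod.snd hxp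
    rw [ho, hl] at hle
    exact ⟨hle, _, ho, hl⟩

/-- The order determines n, and by divisibility the index then determines the mass, so parameters
can be counted as masses. -/
theorem ncard_psi : (Psi 2 5).ncard = 8619 := by
  have hinj : Set.InjOn parameters (allMasses : Set (Σ _ : ℕ, ℕ)) := by
    rintro ⟨m, x⟩ hx ⟨n, y⟩ hy h
    obtain ⟨hm, S, hS, rfl⟩ := mem_allMasses.1 hx
    obtain ⟨hn, T, hT, rfl⟩ := mem_allMasses.1 hy
    obtain rfl : m = n := choose_two_injective hm.1 hn.1 (congrArg Prod.fst h)
    have hd := (solutionCount_spec hm.1 hm.2).2.2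
    have h2 : mass m S / unitMass m = mass m T / unitMass m := congrArg Prod.snd h
    rw [← Nat.mul_div_cancel' (hd S hS), h2, Nat.mul_div_cancel' (hd T hT)]
  rw [psi_eq_image, hinj.ncard_image, Set.ncard_coe_finset, allMasses, Finset.card_sigma,
    ← sum_solutionCount.2]
  refine Finset.sum_congr rfl fun n hn => ?_
  rw [mem_Icc] at hn
  exact (solutionCount_spec hn.1 (by omega)).2.1

theorem not_existsGraphicalDesign {n : ℕ} (hn : 40 ≤ n) (lam : ℕ) :
    ¬ ExistsGraphicalDesign 2 (n.choose 2) 5 lam := by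
  rintro ⟨D, hD, -⟩
  obtain ⟨B, hB, hd, -⟩ := exists_equivalent_ofFamily D
  have h : n = D.n := choose_two_injective (by omega) (five_le hB hd) (by rw [← hD, order_eq])
  have := lt_forty hB hd
  omega

end GraphicalDesigns

theorem mainTheorem3 :
    (GraphicalDesigns.Psi 2 5).ncard = 8619 ∧
    (GraphicalDesigns.classes 2 5).ncard = 271360 ∧
    ∀ n : ℕ, 40 ≤ n → ∀ lam : ℕ,
      ¬ GraphicalDesigns.ExistsGraphicalDesign 2 (n.choose 2) 5 lam := by
  exact ⟨GraphicalDesigns.ncard_psi, GraphicalDesigns.ncard_classes,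
    fun _ hn lam => GraphicalDesigns.not_existsGraphicalDesign hn lam⟩
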